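/- For real $\nu$ and $x>0$ let $J_\nu(x)=\left(\tfrac{x}{2}\right)^{\nu}\sum_{k\ge 0}\frac{(-x^2/4)^k}{k!\,\Gamma(\nu+k+1)}$ and $Y_\nu(x)=\frac{J_\nu(x)\cos\nu\pi-J_{-\nu}(x)}{\sin\nu\pi}$ (replaced by its limiting value if $\nu$ is an integer) be the Bessel functions of the first and second kind. For $\nu\ge 0$ and $s=1,2,\ldots$ let $j_{\nu,s}$, $y_{\nu,s}$, $j'_{\nu,s}$, $y'_{\nu,s}$ denote the $s$-th positive zero, in increasing order, of $J_\nu$, $Y_\nu$, $J'_\nu$, $Y'_\nu$ respectively, except that $x=0$ is counted as the first zero of $J'_0$ (so $j'_{0,1}=0$). Then for every $s=1,2,\ldots$ the zeros below exist and satisfy $$j_{\nu+1,s}<j'_{\nu,s+1}\quad\text{and}\quad y_{\nu+1,s}<y'_{\nu,s}\qquad\text{if }\nu>0,$$ while for $\nu=0$ both relations hold with equality: $j_{1,s}=j'_{0,s+1}$ and $y_{1,s}=y'_{0,s}$. -/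

import Mathlib

noncomputable section

/-- The Bessel function of the first kind of real order `ν`, for `x > 0`:
`J_ν(x) = (x/2)^ν ∑_k (-x²/4)^k / (k! Γ(ν+k+1))`.
Mathlib's `Real.Gamma` is `0` at the non-positive integers, so that `(Γ(ν+k+1))⁻¹ = 0` there,
as the usual convention `1/Γ = 0` at the poles of `Γ` requires. -/
def besselJ (ν x : ℝ) : ℝ :=
  (x / 2) ^ ν *
    ∑' k : ℕ, (-(x ^ 2 / 4)) ^ k / ((k.factorial : ℝ) * Real.Gamma (ν + (k : ℝ) + 1))

/-- The quotient `(J_ν(x) cos νπ - J_{-ν}(x)) / sin νπ`, meaningful for non-integer `ν`. -/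
def besselYQuot (ν x : ℝ) : ℝ :=
  (besselJ ν x * Real.cos (ν * Real.pi) - besselJ (-ν) x) / Real.sin (ν * Real.pi)

open Classical in
/-- The Bessel function of the second kind of real order `ν`, for `x > 0`: the quotient
`(J_ν(x) cos νπ - J_{-ν}(x)) / sin νπ`, replaced by its limiting value if `ν` is an integer. -/
def besselY (ν x : ℝ) : ℝ :=
  if ∃ n : ℤ, ν = (n : ℝ) then
    Filter.limUnder (nhdsWithin ν {ν}ᶜ) (fun μ : ℝ => besselYQuot μ x)
  else besselYQuot ν x

/-- The positive zeros of `J_ν`. -/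
def besselJZeros (ν : ℝ) : Set ℝ := {x | 0 < x ∧ besselJ ν x = 0}

/-- The positive zeros of `Y_ν`. -/
def besselYZeros (ν : ℝ) : Set ℝ := {x | 0 < x ∧ besselY ν x = 0}

/-- The positive zeros of `J'_ν`, to which `x = 0` is adjoined if `ν = 0`
(by convention `x = 0` is counted as the first zero of `J'_0`). -/
def besselJDerivZeros (ν : ℝ) : Set ℝ :=
  {x | (0 < x ∧ deriv (besselJ ν) x = 0) ∨ (ν = 0 ∧ x = 0)}

/-- The positive zeros of `Y'_ν`. -/
def besselYDerivZeros (ν : ℝ) : Set ℝ := {x | 0 < x ∧ deriv (besselY ν) x = 0}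

/-- `x` is the `s`-th element of `S` in increasing order, counted from `s = 1`:
`x ∈ S` and exactly `s` elements of `S` are at most `x`. -/
def IsNthElement (S : Set ℝ) (s : ℕ) (x : ℝ) : Prop :=
  x ∈ S ∧ (S ∩ Set.Iic x).encard = (s : ℕ∞)

/-- The `s`-th element of a set is unique. -/
theorem IsNthElement.unique {S : Set ℝ} {s : ℕ} {x y : ℝ}
    (hx : IsNthElement S s x) (hy : IsNthElement S s y) : x = y := by
  have key : ∀ {a b : ℝ}, IsNthElement S s a → IsNthElement S s b → ¬ a < b := by
    intro a b ha hb hab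
    have hfin : (S ∩ Set.Iic a).Finite := Set.finite_of_encard_eq_coe ha.2
    have hss : S ∩ Set.Iic a ⊂ S ∩ Set.Iic b := by
      refine ⟨fun t ht => ⟨ht.1, le_trans ht.2 hab.le⟩, fun h => ?_⟩
      exact absurd (h ⟨hb.1, le_refl b⟩).2 (not_le.mpr hab)
    have hlt := hfin.encard_lt_encard hss
    rw [ha.2, hb.2] at hlt
    exact lt_irrefl _ hlt
  exact le_antisymm (not_lt.mp (key hy hx)) (not_lt.mp (key hx hy))

end

section

open Set Filter Topology MeasureTheory

/-! ### Counting elements of locally finite sets -/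

/-! Let f and g be the functions of orders ν and ν + 1, both of the first or both of the second
kind. They satisfy f' = (ν/x) f - g and g' = f - ((ν+1)/x) g, so x f' = ν f - x g. They have no
common zero, hence for ν > 0 a zero of f' is a point where f/(x g) = 1/ν. The derivative of f/(x g)
is (2ν f g - x (f² + g²))/(x g)², which is negative for x > ν. So any two zeros of f' beyond ν
enclose a zero of g (`exists_right_eq_zero_between`).

Every positive zero of f' does lie beyond ν: the product f · x f' is monotone on (0, ν]
(`monotoneOn_mul_euler`), positive near 0 for J and negative at ν for Y. Counting gaps gives the
inequality for J. For Y one more zero of g is needed, before the first zero of f'. It comes from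
Y_ν(ν) < 0 < Y'_ν(ν), by which f/(x g) is already below 1/ν at x = ν and cannot climb back to 1/ν
without a zero of g (`exists_right_eq_zero_lt`). For ν = 0, f' = -g and the zero sets agree, up to
the point 0 for J.

The two signs at x = ν are read off Schläfli's integrals, whose phase ν(θ - sin θ) allows an
integration by parts. These integrals solve the same first-order system; comparing behaviour at 0
through constant Wronskians identifies them with J and Y at non-integer orders, and continuity in
the order settles Y at the integers. The same signs show that the Wronskian of J and Y is nonzero,
which excludes common zeros. Infinitude of the zeros follows from a rotating phase angle. -/

theorem exists_isLeast_inter_Ioi {S : Set ℝ} (hfin : ∀ X, (S ∩ Iic X).Finite)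
    (hunb : ∀ X, ∃ x ∈ S, X < x) (c : ℝ) : ∃ x, IsLeast (S ∩ Ioi c) x := by
  obtain ⟨y, hyS, hy⟩ := hunb c
  have hF : (S ∩ Ioc c y).Finite := (hfin y).subset fun t ht => ⟨ht.1, ht.2.2⟩
  obtain ⟨m, hm, hmin⟩ := hF.exists_minimal ⟨y, hyS, hy, le_rfl⟩
  refine ⟨m, ⟨hm.1, hm.2.1⟩, fun t ht => ?_⟩
  by_contra! h
  exact absurd (hmin ⟨ht.1, ht.2, h.le.trans hm.2.2⟩ h.le) (not_le.mpr h)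

theorem exists_isNthElement {S : Set ℝ} (hpos : ∀ x ∈ S, 0 ≤ x)
    (hfin : ∀ X, (S ∩ Iic X).Finite) (hunb : ∀ X, ∃ x ∈ S, X < x) (s : ℕ) (hs : 1 ≤ s) :
    ∃ x, IsNthElement S s x := by
  have key : ∀ n : ℕ, ∃ c, (S ∩ Iic c).encard = (n : ℕ∞) ∧ (1 ≤ n → c ∈ S) := by
    intro n
    induction n with
    | zero =>
      -- All elements are nonnegative, so none is at most -1. This cut is not in `S`, whence the
      -- proviso `1 ≤ n` in the membership clause.
      refine ⟨-1, ?_, by simp⟩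
      rw [Nat.cast_zero, encard_eq_zero, eq_empty_iff_forall_notMem]
      rintro x ⟨hx, hx'⟩
      have := hpos x hx
      rw [mem_Iic] at hx'
      linarith
    | succ n ih =>
      obtain ⟨c, hc, -⟩ := ih
      obtain ⟨d, ⟨hdS, hd⟩, hmin⟩ := exists_isLeast_inter_Ioi hfin hunb c
      refine ⟨d, ?_, fun _ => hdS⟩
      have : S ∩ Iic d = insert d (S ∩ Iic c) := by
        ext t
        simp only [mem_inter_iff, mem_Iic, mem_insert_iff]
        constructor
        · rintro ⟨h1, h2⟩
          by_cases h : c < t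
          · exact Or.inl (le_antisymm h2 (hmin ⟨h1, h⟩))
          · exact Or.inr ⟨h1, not_lt.mp h⟩
        · rintro (rfl | ⟨h1, h2⟩)
          · exact ⟨hdS, le_rfl⟩
          · exact ⟨h1, h2.trans (le_of_lt hd)⟩
      rw [this, encard_insert_of_notMem (fun h => absurd (mem_Iic.mp h.2) (not_le.mpr hd)), hc]
      push_cast
      rfl
  obtain ⟨c, hc, hcS⟩ := key s
  exact ⟨c, hcS hs, hc⟩

/-- This index shift serves both the convention that 0 is the first zero of J'_0 and the artificial
zero adjoined to those of Y'_ν. -/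
theorem IsNthElement.insert_zero {S : Set ℝ} (hpos : ∀ x ∈ S, 0 < x) {s : ℕ} {x : ℝ}
    (hx : IsNthElement S s x) : IsNthElement (insert 0 S) (s + 1) x := by
  refine ⟨mem_insert_of_mem _ hx.1, ?_⟩
  rw [insert_inter_of_mem (mem_Iic.mpr (hpos x hx.1).le),
    encard_insert_of_notMem (fun h => lt_irrefl _ (hpos 0 h.1)), hx.2]
  push_cast
  rfl

/-- Induction from `b` to its predecessor `c` in `B`: the gap between `c` and `b` supplies one
element of `A` beyond those below `c`. -/
theorem le_encard_inter_Iio_of_between {A B : Set ℝ} (hfin : ∀ X, (B ∩ Iic X).Finite)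
    (hbtw : ∀ b ∈ B, ∀ b' ∈ B, b < b' → ∃ a ∈ A, b < a ∧ a < b') (n : ℕ) :
    ∀ b ∈ B, ((n + 1 : ℕ) : ℕ∞) ≤ (B ∩ Iic b).encard → (n : ℕ∞) ≤ (A ∩ Iio b).encard := by
  induction n with
  | zero => simp
  | succ n ih =>
    intro b hb hcard
    have hins : B ∩ Iic b = insert b (B ∩ Iio b) := by
      ext t
      simp only [mem_inter_iff, mem_Iic, mem_insert_iff, mem_Iio, le_iff_eq_or_lt]
      constructor
      · tauto
      · rintro (rfl | h)
        · exact ⟨hb, Or.inl rfl⟩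
        · exact ⟨h.1, Or.inr h.2⟩
    have hcard' : ((n + 1 : ℕ) : ℕ∞) ≤ (B ∩ Iio b).encard := by
      rw [hins, encard_insert_of_notMem (fun h => lt_irrefl _ (mem_Iio.mp h.2))] at hcard
      push_cast at hcard ⊢
      exact (ENat.add_le_add_iff_right (by simp)).mp hcard
    have hne : (B ∩ Iio b).Nonempty := by
      rw [← encard_pos]
      refine lt_of_lt_of_le ?_ hcard'
      exact_mod_cast Nat.succ_pos n
    obtain ⟨c, hc, hmax⟩ :=
      ((hfin b).subset fun t (ht : t ∈ B ∩ Iio b) => ⟨ht.1, mem_Iic.mpr (le_of_lt ht.2)⟩).exists_maximal hne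
    have hsub : B ∩ Iio b ⊆ B ∩ Iic c := fun t ht =>
      ⟨ht.1, by
        rw [mem_Iic]
        by_contra! h
        exact absurd (hmax ht h.le) (not_le.mpr h)⟩
    obtain ⟨a, haA, hca, hab⟩ := hbtw c hc.1 b hb hc.2
    have h1 := ih c hc.1 (hcard'.trans (encard_le_encard hsub))
    calc ((n + 1 : ℕ) : ℕ∞) = (n : ℕ∞) + 1 := by push_cast; rfl
      _ ≤ (A ∩ Iio c).encard + 1 := by gcongr
      _ = (insert a (A ∩ Iio c)).encard :=
        (encard_insert_of_notMem fun h => absurd h.2 (not_lt.mpr hca.le)).symm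
      _ ≤ (A ∩ Iio b).encard := by
        refine encard_le_encard (insert_subset ⟨haA, hab⟩ fun t ht => ⟨ht.1, ?_⟩)
        exact lt_trans (mem_Iio.mp ht.2) (mem_Iio.mp hc.2)

theorem IsNthElement.lt_of_between {A B : Set ℝ} (hfin : ∀ X, (B ∩ Iic X).Finite)
    (hbtw : ∀ b ∈ B, ∀ b' ∈ B, b < b' → ∃ a ∈ A, b < a ∧ a < b') {s : ℕ} {a b : ℝ}
    (ha : IsNthElement A s a) (hb : IsNthElement B (s + 1) b) : a < b := by
  have h1 := le_encard_inter_Iio_of_between hfin hbtw s b hb.1 hb.2.ge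
  by_contra! h
  have hA : (A ∩ Iic a).Finite := finite_of_encard_eq_coe ha.2
  have hss : A ∩ Iio b ⊂ A ∩ Iic a := by
    refine ⟨fun t ht => ⟨ht.1, (le_of_lt ht.2).trans h⟩, fun h' => ?_⟩
    exact absurd (h' ⟨ha.1, le_refl a⟩).2 (not_lt.mpr h)
  have := (hA.subset hss.subset).encard_lt_encard hss
  rw [ha.2] at this
  exact absurd h1 (not_le.mpr this)

/-- A function with nonzero derivative at each of its zeros, all of which exceed `m`,
has finitely many zeros below any bound. -/
theorem finite_zeros_inter_Iic {h : ℝ → ℝ} {m : ℝ} {Z : Set ℝ}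
    (hZ : Z ⊆ {x | m < x ∧ h x = 0}) (hcont : ContinuousOn h (Ici m))
    (hder : ∀ x, m ≤ x → h x = 0 → ∃ h', h' ≠ 0 ∧ HasDerivAt h h' x) (X : ℝ) :
    (Z ∩ Iic X).Finite := by
  -- Infinitely many zeros in the compact interval `[m, X]` would accumulate at some `z`; by
  -- continuity `z` is a zero, and its nonzero derivative isolates it.
  by_contra hinf
  have hsub : Z ∩ Iic X ⊆ Icc m X := fun t ht => ⟨(hZ ht.1).1.le, ht.2⟩
  obtain ⟨z, hz, hacc⟩ := Set.Infinite.exists_accPt_of_subset_isCompact hinf isCompact_Icc hsub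
  have hfreq : ∃ᶠ y in 𝓝[≠] z, y ∈ Z ∩ Iic X := accPt_iff_frequently_nhdsNE.mp hacc
  have hz0 : h z = 0 := by
    have hcl : z ∈ closure (Ici m ∩ h ⁻¹' {0}) := by
      refine closure_mono ?_ (mem_closure_iff_clusterPt.mpr hacc.clusterPt)
      exact fun t ht => ⟨(hZ ht.1).1.le, (hZ ht.1).2⟩
    rw [(hcont.preimage_isClosed_of_isClosed isClosed_Ici isClosed_singleton).closure_eq] at hcl
    exact hcl.2
  obtain ⟨h', hne, hd⟩ := hder z hz.1 hz0
  obtain ⟨y, hy, hy'⟩ := (hfreq.and_eventually (hd.eventually_ne (c := 0) hne)).exists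
  exact hy' (hZ hy.1).2

/-! ### The first-order system of Bessel functions of neighbouring orders -/

/-- The system satisfied on `(0, ∞)` by two cylinder functions of orders `ν` and `ν + 1`. -/
structure IsBesselPair (ν : ℝ) (f g : ℝ → ℝ) : Prop where
  left : ∀ x, 0 < x → HasDerivAt f (ν / x * f x - g x) x
  right : ∀ x, 0 < x → HasDerivAt g (f x - (ν + 1) / x * g x) x

namespace IsBesselPair

variable {ν : ℝ} {f g f₁ g₁ : ℝ → ℝ}

theorem sub (h : IsBesselPair ν f g) (h₁ : IsBesselPair ν f₁ g₁) :
    IsBesselPair ν (f - f₁) (g - g₁) where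
  left x hx := by
    refine ((h.left x hx).sub (h₁.left x hx)).congr_deriv ?_
    simp only [Pi.sub_apply]
    ring
  right x hx := by
    refine ((h.right x hx).sub (h₁.right x hx)).congr_deriv ?_
    simp only [Pi.sub_apply]
    ring

/-- The trace of the system is -1/x, so x times the Wronskian is constant. -/
theorem wronskian_eq (h : IsBesselPair ν f g) (h₁ : IsBesselPair ν f₁ g₁) {x y : ℝ}
    (hx : 0 < x) (hy : 0 < y) :
    x * (f x * g₁ x - g x * f₁ x) = y * (f y * g₁ y - g y * f₁ y) := by
  have hd : ∀ t ∈ Ioi (0 : ℝ),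
      HasDerivAt (fun t => t * (f t * g₁ t - g t * f₁ t)) 0 t := by
    intro t ht
    have ht0 : t ≠ 0 := (mem_Ioi.mp ht).ne'
    refine ((hasDerivAt_id t).mul (((h.left t ht).mul (h₁.right t ht)).sub
      ((h.right t ht).mul (h₁.left t ht)))).congr_deriv ?_
    simp only [id, Pi.sub_apply, Pi.mul_apply]
    field_simp
    ring
  exact (convex_Ioi (0 : ℝ)).is_const_of_fderivWithin_eq_zero (𝕜 := ℝ)
    (fun t ht => (hd t ht).differentiableAt.differentiableWithinAt)
    (fun t ht => by
      rw [fderivWithin_of_isOpen isOpen_Ioi ht]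
      have := (hd t ht).hasFDerivAt.fderiv
      rw [this]
      ext
      simp) hx hy

theorem wronskian_eq_of_tendsto (h : IsBesselPair ν f g) (h₁ : IsBesselPair ν f₁ g₁) {L : ℝ}
    (hL : Tendsto (fun x => x * (f x * g₁ x - g x * f₁ x)) (𝓝[>] 0) (𝓝 L)) {x : ℝ}
    (hx : 0 < x) : x * (f x * g₁ x - g x * f₁ x) = L := by
  refine tendsto_nhds_unique (tendsto_const_nhds.congr' ?_) hL
  filter_upwards [self_mem_nhdsWithin] with t ht
  exact h.wronskian_eq h₁ hx ht

/-- This is Bessel's equation in the form x (x f')' = (ν² - x²) f. -/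
theorem hasDerivAt_euler (h : IsBesselPair ν f g) {x : ℝ} (hx : 0 < x) :
    HasDerivAt (fun t => ν * f t - t * g t) ((ν ^ 2 / x - x) * f x) x := by
  refine (((h.left x hx).const_mul ν).sub
    ((hasDerivAt_id x).mul (h.right x hx))).congr_deriv ?_
  simp only [id]
  field_simp
  ring

/-- With E = x f', the derivative of f E is (E² + (ν² - t²) f²)/t, nonnegative up to ν. A sign of f
f' known at one end therefore spreads over the interval. -/
theorem monotoneOn_mul_euler (h : IsBesselPair ν f g) :
    MonotoneOn (fun t => f t * (ν * f t - t * g t)) (Ioc 0 ν) := by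
  have hd : ∀ t, 0 < t → HasDerivAt (fun t => f t * (ν * f t - t * g t))
      ((ν / t * f t - g t) * (ν * f t - t * g t) + f t * ((ν ^ 2 / t - t) * f t)) t :=
    fun t ht => (h.left t ht).mul (h.hasDerivAt_euler ht)
  refine monotoneOn_of_deriv_nonneg (convex_Ioc 0 ν)
    (fun t ht => (hd t ht.1).continuousAt.continuousWithinAt)
    (fun t ht => (hd t (interior_subset ht).1).differentiableAt.differentiableWithinAt)
    fun t ht => ?_
  obtain ⟨ht0, htν⟩ := interior_subset ht
  rw [(hd t ht0).deriv]
  have : (ν / t * f t - g t) * (ν * f t - t * g t) + f t * ((ν ^ 2 / t - t) * f t)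
      = ((ν * f t - t * g t) ^ 2 + (ν - t) * (ν + t) * f t ^ 2) / t := by
    field_simp
    ring
  rw [this]
  have h1 : 0 ≤ ν - t := sub_nonneg.mpr htν
  have h2 : 0 ≤ ν + t := by linarith
  positivity

/-- The numerator of the derivative is 2ν f g - t (f² + g²), and 2 f g ≤ f² + g² makes it negative
once t > ν. -/
theorem quotient_lt (h : IsBesselPair ν f g) (hν : 0 ≤ ν) {a b : ℝ} (ha0 : 0 < a) (ha : ν ≤ a) (hab : a < b)
    (hg : ∀ x ∈ Icc a b, g x ≠ 0) : f b / (b * g b) < f a / (a * g a) := by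
  have hd : ∀ t ∈ Icc a b, HasDerivAt (fun t => f t / (t * g t))
      (-(t * (f t ^ 2 + g t ^ 2) - 2 * ν * (f t * g t)) / (t * g t) ^ 2) t := by
    intro t ht
    have ht0 : 0 < t := ha0.trans_le ht.1
    refine ((h.left t ht0).div ((hasDerivAt_id t).mul (h.right t ht0))
      (mul_ne_zero ht0.ne' (hg t ht))).congr_deriv ?_
    have := hg t ht
    simp only [id, Pi.mul_apply]
    field_simp
    ring
  refine strictAntiOn_of_deriv_neg (convex_Icc a b)
    (fun t ht => (hd t ht).continuousAt.continuousWithinAt) (fun t ht => ?_)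
    (left_mem_Icc.mpr hab.le) (right_mem_Icc.mpr hab.le) hab
  rw [interior_Icc] at ht
  have ht0 : 0 < t := ha0.trans ht.1
  have hgt := hg t (Ioo_subset_Icc_self ht)
  rw [(hd t (Ioo_subset_Icc_self ht)).deriv, neg_div, neg_lt_zero]
  refine div_pos ?_ (by positivity)
  have h1 : 0 < f t ^ 2 + g t ^ 2 := by positivity
  have h2 : ν < t := ha.trans_lt ht.1
  nlinarith [mul_pos (sub_pos.mpr h2) h1, mul_nonneg hν (sq_nonneg (f t - g t))]

end IsBesselPair

/-! ### Existence, separation and discreteness of zeros -/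

namespace IsBesselPair

variable {ν : ℝ} {f g : ℝ → ℝ}

/-- Past |2ν + 1| the phase angle arctan(f/g) decreases at rate at least 1/2, yet it stays within an
interval of length π as long as g does not vanish. -/
theorem exists_right_eq_zero_gt (h : IsBesselPair ν f g) (X : ℝ) : ∃ x, X < x ∧ g x = 0 := by
  by_contra! hne
  set a := max X 0 + |2 * ν + 1| + 1 with ha
  have hXa : X < a := by
    have := le_max_left X 0
    have := abs_nonneg (2 * ν + 1)
    linarith
  have hνa : |2 * ν + 1| ≤ a := by
    have := le_max_right X 0
    linarith
  have ha0 : 0 < a := by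
    have := le_max_right X 0
    have := abs_nonneg (2 * ν + 1)
    linarith
  have hd : ∀ t ∈ Ici a, HasDerivAt (fun t => Real.arctan (f t / g t) + t / 2)
      (-(f t ^ 2 + g t ^ 2 - 2 * ((2 * ν + 1) / t * (f t * g t))) /
        (2 * (f t ^ 2 + g t ^ 2))) t := by
    intro t ht
    have hat : a ≤ t := ht
    have ht0 : 0 < t := ha0.trans_le hat
    have hg := hne t (hXa.trans_le hat)
    have hpos : f t ^ 2 + g t ^ 2 ≠ 0 := by positivity
    refine (((h.left t ht0).div (h.right t ht0) hg).arctan.add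
      ((hasDerivAt_id t).div_const 2)).congr_deriv ?_
    simp only [Pi.div_apply]
    have : 1 + (f t / g t) ^ 2 = (f t ^ 2 + g t ^ 2) / g t ^ 2 := by
      field_simp
      ring
    rw [this]
    field_simp
    ring
  have hanti : AntitoneOn (fun t => Real.arctan (f t / g t) + t / 2) (Ici a) := by
    refine antitoneOn_of_deriv_nonpos (convex_Ici a)
      (fun t ht => (hd t ht).continuousAt.continuousWithinAt)
      (fun t ht => (hd t (interior_subset ht)).differentiableAt.differentiableWithinAt)
      fun t ht => ?_
    have hat : a ≤ t := interior_subset ht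
    have ht0 : 0 < t := ha0.trans_le hat
    rw [(hd t hat).deriv, neg_div, neg_nonpos]
    refine div_nonneg ?_ (by positivity)
    have h1 : |(2 * ν + 1) / t| ≤ 1 := by
      rw [abs_div, abs_of_pos ht0, div_le_one ht0]
      exact hνa.trans hat
    obtain ⟨h2, h3⟩ := abs_le.mp h1
    nlinarith [mul_nonneg (sub_nonneg.mpr h3) (sq_nonneg (f t + g t)),
      mul_nonneg (neg_le_iff_add_nonneg.mp h2) (sq_nonneg (f t - g t))]
  -- Over a length of 7 the angle drops by at least 7/2 > π.
  have h1 := hanti (mem_Ici.mpr le_rfl) (mem_Ici.mpr (by linarith : a ≤ a + 7))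
    (by linarith : a ≤ a + 7)
  simp only at h1
  have h2 := Real.neg_pi_div_two_lt_arctan (f (a + 7) / g (a + 7))
  have h3 := Real.arctan_lt_pi_div_two (f a / g a)
  have h4 := Real.pi_lt_d2
  linarith

/-- Rolle's theorem applied to t^(ν+1) g, whose derivative is t^(ν+1) f. -/
theorem exists_left_eq_zero_gt (h : IsBesselPair ν f g) (X : ℝ) : ∃ x, X < x ∧ f x = 0 := by
  obtain ⟨a, ha, hga⟩ := h.exists_right_eq_zero_gt (max X 0)
  obtain ⟨b, hb, hgb⟩ := h.exists_right_eq_zero_gt a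
  have ha0 : 0 < a := (le_max_right X 0).trans_lt ha
  have hd : ∀ t, 0 < t → HasDerivAt (fun t => t ^ (ν + 1) * g t) (t ^ (ν + 1) * f t) t := by
    intro t ht
    refine ((Real.hasDerivAt_rpow_const (Or.inl ht.ne')).mul (h.right t ht)).congr_deriv ?_
    rw [show ν + 1 - 1 = ν by ring, Real.rpow_add_one ht.ne']
    field_simp
    ring
  obtain ⟨c, hc, hc0⟩ := exists_hasDerivAt_eq_zero hb
    (fun t ht => (hd t (ha0.trans_le ht.1)).continuousAt.continuousWithinAt)
    (by rw [hga, hgb]; simp) (fun t ht => hd t (ha0.trans ht.1))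
  have hcpos : 0 < c := ha0.trans hc.1
  refine ⟨c, ((le_max_left X 0).trans_lt ha).trans hc.1, ?_⟩
  exact (mul_eq_zero.mp hc0).resolve_left (Real.rpow_pos_of_pos hcpos _).ne'

theorem deriv_left (h : IsBesselPair ν f g) {x : ℝ} (hx : 0 < x) :
    deriv f x = (ν * f x - x * g x) / x := by
  rw [(h.left x hx).deriv]
  field_simp

theorem deriv_left_eq_zero_iff (h : IsBesselPair ν f g) {x : ℝ} (hx : 0 < x) :
    deriv f x = 0 ↔ ν * f x - x * g x = 0 := by
  rw [h.deriv_left hx, div_eq_zero_iff]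
  exact or_iff_left hx.ne'

theorem exists_deriv_left_eq_zero_gt (h : IsBesselPair ν f g) (X : ℝ) :
    ∃ x, X < x ∧ deriv f x = 0 := by
  obtain ⟨a, ha, hfa⟩ := h.exists_left_eq_zero_gt (max X 0)
  obtain ⟨b, hb, hfb⟩ := h.exists_left_eq_zero_gt a
  have ha0 : 0 < a := (le_max_right X 0).trans_lt ha
  obtain ⟨c, hc, hc0⟩ := exists_deriv_eq_zero hb
    (fun t ht => (h.left t (ha0.trans_le ht.1)).continuousAt.continuousWithinAt)
    (hfa.trans hfb.symm)
  exact ⟨c, ((le_max_left X 0).trans_lt ha).trans hc.1, hc0⟩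

/-- Two zeros of the derivative of `f` beyond `ν` are separated by a zero of `g`. -/
theorem exists_right_eq_zero_between (h : IsBesselPair ν f g) (hν : 0 < ν)
    (hsim : ∀ x, 0 < x → f x = 0 → g x ≠ 0) {a b : ℝ} (ha : ν ≤ a) (hab : a < b)
    (hfa : ν * f a - a * g a = 0) (hfb : ν * f b - b * g b = 0) :
    ∃ c, g c = 0 ∧ a < c ∧ c < b := by
  -- A zero of f' is a point where the quotient f/(t g) takes the value 1/ν, which a strictly
  -- decreasing function cannot take twice.
  have key : ∀ t, ν ≤ t → ν * f t - t * g t = 0 → g t ≠ 0 ∧ f t / (t * g t) = 1 / ν := by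
    intro t ht h0
    have ht0 : 0 < t := hν.trans_le ht
    have hgt : g t ≠ 0 := by
      intro hg
      rw [hg, mul_zero, sub_zero] at h0
      exact hsim t ht0 ((mul_eq_zero.mp h0).resolve_left hν.ne') hg
    refine ⟨hgt, ?_⟩
    rw [div_eq_div_iff (mul_ne_zero ht0.ne' hgt) hν.ne']
    linarith
  by_contra! hne
  have hg : ∀ x ∈ Icc a b, g x ≠ 0 := by
    intro x hx hgx
    rcases hx.1.eq_or_lt with rfl | hax
    · exact (key a ha hfa).1 hgx
    rcases hx.2.eq_or_lt with rfl | hxb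
    · exact (key x (ha.trans hab.le) hfb).1 hgx
    · exact absurd hxb (not_lt.mpr (hne x hgx hax))
  have := h.quotient_lt hν.le (hν.trans_le ha) ha hab hg
  rw [(key a ha hfa).2, (key b (ha.trans hab.le) hfb).2] at this
  exact lt_irrefl _ this

/-- If `f ν < 0 < f' ν`, then `g` vanishes before the first zero of `f'` beyond `ν`. -/
theorem exists_right_eq_zero_lt (h : IsBesselPair ν f g) (hν : 0 < ν)
    (hsim : ∀ x, 0 < x → f x = 0 → g x ≠ 0) {b : ℝ} (hb : ν < b)
    (hf : f ν < 0) (hf' : 0 < ν * f ν - ν * g ν) (hfb : ν * f b - b * g b = 0) :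
    ∃ c, g c = 0 ∧ 0 < c ∧ c < b := by
  have hgf : g ν < f ν := by
    by_contra! hle
    have := mul_le_mul_of_nonneg_left hle hν.le
    linarith
  by_contra! hne
  have hb0 : 0 < b := hν.trans hb
  have hgb : g b ≠ 0 := by
    intro hg
    rw [hg, mul_zero, sub_zero] at hfb
    exact hsim b hb0 ((mul_eq_zero.mp hfb).resolve_left hν.ne') hg
  have hg : ∀ x ∈ Icc ν b, g x ≠ 0 := by
    intro x hx hgx
    rcases hx.2.eq_or_lt with rfl | hxb
    · exact hgb hgx
    · exact absurd hxb (not_lt.mpr (hne x hgx (hν.trans_le hx.1)))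
  have h1 := h.quotient_lt hν.le hν le_rfl hb hg
  have h2 : f b / (b * g b) = 1 / ν := by
    rw [div_eq_div_iff (mul_ne_zero hb0.ne' hgb) hν.ne']
    linarith
  -- Both values are negative and g ν < f ν, so f ν / g ν < 1.
  have h3 : f ν / (ν * g ν) < 1 / ν := by
    rw [mul_comm, ← div_div]
    gcongr
    rw [div_lt_one_of_neg (hgf.trans hf)]
    exact hgf
  linarith

/-- A pair with `f f' ≠ 0` on `(0, ν]` whose members have no common zero has, up to any bound,
finitely many zeros of `f`. -/
theorem finite_left_zeros (h : IsBesselPair ν f g) (hν : 0 < ν)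
    (hne : ∀ x ∈ Ioc 0 ν, f x * (ν * f x - x * g x) ≠ 0)
    (hsim : ∀ x, 0 < x → f x = 0 → g x ≠ 0) (X : ℝ) :
    ({x | 0 < x ∧ f x = 0} ∩ Iic X).Finite := by
  refine finite_zeros_inter_Iic (h := f) (m := ν) (fun x hx => ⟨?_, hx.2⟩)
    (fun x hx => (h.left x (hν.trans_le hx)).continuousAt.continuousWithinAt)
    (fun x hx hfx => ⟨_, ?_, h.left x (hν.trans_le hx)⟩) X
  · by_contra! hle
    exact hne x ⟨hx.1, hle⟩ (by rw [hx.2, zero_mul])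
  · rw [hfx, mul_zero, zero_sub, neg_ne_zero]
    exact hsim x (hν.trans_le hx) hfx

theorem lt_of_deriv_left_eq_zero (h : IsBesselPair ν f g)
    (hne : ∀ x ∈ Ioc 0 ν, f x * (ν * f x - x * g x) ≠ 0) {x : ℝ} (hx : 0 < x)
    (hfx : deriv f x = 0) : ν < x := by
  by_contra! hle
  exact hne x ⟨hx, hle⟩ (by rw [(h.deriv_left_eq_zero_iff hx).mp hfx, mul_zero])

theorem finite_deriv_left_zeros (h : IsBesselPair ν f g) (hν : 0 < ν)
    (hne : ∀ x ∈ Ioc 0 ν, f x * (ν * f x - x * g x) ≠ 0)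
    (hsim : ∀ x, 0 < x → f x = 0 → g x ≠ 0) (X : ℝ) :
    ({x | 0 < x ∧ deriv f x = 0} ∩ Iic X).Finite := by
  refine finite_zeros_inter_Iic (h := fun x => ν * f x - x * g x) (m := ν)
    (fun x hx => ⟨h.lt_of_deriv_left_eq_zero hne hx.1 hx.2,
      (h.deriv_left_eq_zero_iff hx.1).mp hx.2⟩)
    (fun x hx => (h.hasDerivAt_euler (hν.trans_le hx)).continuousAt.continuousWithinAt)
    (fun x hx hfx => ⟨_, ?_, h.hasDerivAt_euler (hν.trans_le hx)⟩) X
  have hx0 : 0 < x := hν.trans_le hx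
  have hνx : ν < x := h.lt_of_deriv_left_eq_zero hne hx0 ((h.deriv_left_eq_zero_iff hx0).mpr hfx)
  -- The zero is simple: the first factor vanishes only at x = ±ν, and f x = 0 would make g x = 0 as
  -- well.
  refine mul_ne_zero (fun h0 => ?_) fun h0 => ?_
  · have : ν ^ 2 / x - x = -((x - ν) * (x + ν)) / x := by
      field_simp
      ring
    rw [this, div_eq_zero_iff, neg_eq_zero, mul_eq_zero] at h0
    rcases h0 with (h0 | h0) | h0 <;> linarith
  · simp only [h0, mul_zero, zero_sub, neg_eq_zero, mul_eq_zero] at hfx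
    exact hsim x hx0 h0 (hfx.resolve_left hx0.ne')

end IsBesselPair

/-! ### The power series of the Bessel functions of the first kind -/

/-- With the value 0 of Γ at its poles, the functional equation of 1/Γ needs no exception. -/
theorem Real.inv_Gamma_eq_mul (s : ℝ) : (Real.Gamma s)⁻¹ = s * (Real.Gamma (s + 1))⁻¹ := by
  rcases eq_or_ne s 0 with rfl | hs
  · simp [Real.Gamma_zero]
  · rw [Real.Gamma_add_one hs, mul_inv, mul_inv_cancel_left₀ hs]

/-- All but finitely many arguments are at least 2, where Γ ≥ 1. The bound lets the exponential
series dominate the Bessel series. -/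
theorem exists_inv_Gamma_le (ν : ℝ) :
    ∃ C, 0 ≤ C ∧ ∀ k : ℕ, |(Real.Gamma (ν + k + 1))⁻¹| ≤ C := by
  obtain ⟨N, hN⟩ := exists_nat_ge (1 - ν)
  refine ⟨1 + ∑ k ∈ Finset.range N, |(Real.Gamma (ν + k + 1))⁻¹|, by positivity, fun k => ?_⟩
  by_cases hk : k < N
  · have := Finset.single_le_sum (f := fun k : ℕ => |(Real.Gamma (ν + k + 1))⁻¹|)
      (fun i _ => abs_nonneg _) (Finset.mem_range.mpr hk)
    linarith
  · have hNk : (N : ℝ) ≤ k := by exact_mod_cast not_lt.mp hk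
    have h2 : (2 : ℝ) ≤ ν + k + 1 := by linarith
    have h1 : 1 ≤ Real.Gamma (ν + k + 1) := by
      have := Real.Gamma_strictMonoOn_Ici.monotoneOn (mem_Ici.mpr le_rfl) (mem_Ici.mpr h2) h2
      rwa [Real.Gamma_two] at this
    have h0 : 0 ≤ ∑ k ∈ Finset.range N, |(Real.Gamma (ν + k + 1))⁻¹| := by positivity
    rw [abs_of_nonneg (by positivity)]
    have := inv_le_one_of_one_le₀ h1
    linarith

/-- The entire function `z ↦ ∑ z ^ k / (k! Γ(ν + k + 1))`. -/
noncomputable def besselSeries (ν z : ℝ) : ℝ :=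
  ∑' k : ℕ, z ^ k / ((k.factorial : ℝ) * Real.Gamma (ν + (k : ℝ) + 1))

theorem summable_besselSeries (ν z : ℝ) :
    Summable fun k : ℕ => z ^ k / ((k.factorial : ℝ) * Real.Gamma (ν + (k : ℝ) + 1)) := by
  obtain ⟨C, hC, h⟩ := exists_inv_Gamma_le ν
  refine Summable.of_norm_bounded ((Real.summable_pow_div_factorial |z|).mul_left C) fun k => ?_
  rw [Real.norm_eq_abs, ← div_div, div_eq_mul_inv, abs_mul, mul_comm, abs_div, abs_pow,
    Nat.abs_cast]
  gcongr
  exact h k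

theorem hasDerivAt_besselSeries (ν z : ℝ) :
    HasDerivAt (besselSeries ν) (besselSeries (ν + 1) z) z := by
  obtain ⟨C, hC, h⟩ := exists_inv_Gamma_le ν
  set R := |z| + 1 with hR
  have hR0 : 0 ≤ R := by positivity
  have hu : Summable fun k : ℕ => C * (k * R ^ (k - 1) / (k.factorial : ℝ)) := by
    refine Summable.mul_left C ((summable_nat_add_iff 1).mp ?_)
    refine (Real.summable_pow_div_factorial R).congr fun k => ?_
    rw [Nat.factorial_succ, Nat.add_sub_cancel]
    push_cast
    field_simp
  have hz : z ∈ Metric.ball (0 : ℝ) R := by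
    rw [mem_ball_zero_iff, Real.norm_eq_abs, hR]
    linarith
  have hd := hasDerivAt_tsum_of_isPreconnected hu Metric.isOpen_ball
    (convex_ball (0 : ℝ) R).isPreconnected
    (g := fun (k : ℕ) z => z ^ k / ((k.factorial : ℝ) * Real.Gamma (ν + (k : ℝ) + 1)))
    (g' := fun (k : ℕ) z => k * z ^ (k - 1) / ((k.factorial : ℝ) * Real.Gamma (ν + (k : ℝ) + 1)))
    (fun k y _ => (hasDerivAt_pow k y).div_const _)
    (fun k y hy => by
      rw [mem_ball_zero_iff, Real.norm_eq_abs] at hy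
      rw [Real.norm_eq_abs, ← div_div, div_eq_mul_inv, abs_mul, mul_comm, abs_div, abs_mul,
        abs_pow, Nat.abs_cast, Nat.abs_cast]
      gcongr
      exact h k)
    hz (summable_besselSeries ν z) hz
  refine hd.congr_deriv ?_
  have hs : Summable fun k : ℕ =>
      (k : ℝ) * z ^ (k - 1) / ((k.factorial : ℝ) * Real.Gamma (ν + (k : ℝ) + 1)) := by
    refine (summable_nat_add_iff 1).mp ((summable_besselSeries (ν + 1) z).congr fun k => ?_)
    rw [Nat.factorial_succ, Nat.add_sub_cancel]
    push_cast
    rw [show ν + (k + 1 : ℝ) + 1 = ν + 1 + k + 1 by ring]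
    field_simp
  rw [hs.tsum_eq_zero_add, besselSeries]
  simp only [Nat.cast_zero, zero_mul, zero_div, zero_add]
  refine tsum_congr fun k => ?_
  rw [Nat.factorial_succ, Nat.add_sub_cancel]
  push_cast
  rw [show ν + (k + 1 : ℝ) + 1 = ν + 1 + k + 1 by ring]
  field_simp

/-- Termwise, 1/Γ(ν+k+1) = ((ν+1) + k)/Γ(ν+k+2); the part with factor k is the series of order ν + 2
with its index shifted. -/
theorem besselSeries_eq_add (ν z : ℝ) :
    besselSeries ν z = (ν + 1) * besselSeries (ν + 1) z + z * besselSeries (ν + 2) z := by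
  have h2 : z * besselSeries (ν + 2) z = ∑' k : ℕ, (k : ℝ) *
      (z ^ k / ((k.factorial : ℝ) * Real.Gamma (ν + 1 + (k : ℝ) + 1))) ∧
      Summable fun k : ℕ => (k : ℝ) *
      (z ^ k / ((k.factorial : ℝ) * Real.Gamma (ν + 1 + (k : ℝ) + 1))) := by
    have hterm : ∀ k : ℕ, z * (z ^ k / ((k.factorial : ℝ) * Real.Gamma (ν + 2 + (k : ℝ) + 1)))
        = ((k + 1 : ℕ) : ℝ) * (z ^ (k + 1) / (((k + 1).factorial : ℝ) *
          Real.Gamma (ν + 1 + ((k + 1 : ℕ) : ℝ) + 1))) := by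
      intro k
      rw [Nat.factorial_succ]
      push_cast
      rw [show ν + 1 + (k + 1 : ℝ) + 1 = ν + 2 + k + 1 by ring, pow_succ]
      field_simp
    have hs : Summable fun k : ℕ => (k : ℝ) *
        (z ^ k / ((k.factorial : ℝ) * Real.Gamma (ν + 1 + (k : ℝ) + 1))) :=
      (summable_nat_add_iff 1).mp (((summable_besselSeries (ν + 2) z).mul_left z).congr hterm)
    refine ⟨?_, hs⟩
    rw [hs.tsum_eq_zero_add, besselSeries, ← tsum_mul_left]
    simp only [Nat.cast_zero, zero_mul, zero_add]
    exact tsum_congr hterm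
  rw [h2.1, besselSeries, besselSeries, ← tsum_mul_left,
    ← ((summable_besselSeries (ν + 1) z).mul_left (ν + 1)).tsum_add h2.2]
  refine tsum_congr fun k => ?_
  have := Real.inv_Gamma_eq_mul (ν + k + 1)
  rw [show ν + k + 1 + 1 = ν + 1 + k + 1 by ring] at this
  rw [← div_div, ← div_div, div_eq_mul_inv _ (Real.Gamma (ν + k + 1)), this]
  ring

theorem besselSeries_zero (ν : ℝ) : besselSeries ν 0 = (Real.Gamma (ν + 1))⁻¹ := by
  rw [besselSeries, tsum_eq_single 0 (fun k hk => by rw [zero_pow hk, zero_div])]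
  simp

theorem besselJ_eq (ν x : ℝ) : besselJ ν x = (x / 2) ^ ν * besselSeries ν (-(x ^ 2 / 4)) := rfl

theorem tendsto_besselSeries (ν : ℝ) :
    Tendsto (fun x : ℝ => besselSeries ν (-(x ^ 2 / 4))) (𝓝[>] 0) (𝓝 (Real.Gamma (ν + 1))⁻¹) := by
  have hc : Continuous (besselSeries ν) :=
    continuous_iff_continuousAt.mpr fun z => (hasDerivAt_besselSeries ν z).continuousAt
  have : Continuous fun x : ℝ => besselSeries ν (-(x ^ 2 / 4)) := hc.comp (by fun_prop)
  have h := this.tendsto 0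
  simp only [ne_eq, OfNat.ofNat_ne_zero, not_false_eq_true, zero_pow, zero_div, neg_zero,
    besselSeries_zero] at h
  exact h.mono_left nhdsWithin_le_nhds

theorem besselJ_add_besselJ_add_two (ν : ℝ) {x : ℝ} (hx : 0 < x) :
    besselJ ν x + besselJ (ν + 2) x = 2 * (ν + 1) / x * besselJ (ν + 1) x := by
  have h2 : x / 2 ≠ 0 := by positivity
  rw [besselJ_eq, besselJ_eq, besselJ_eq, besselSeries_eq_add ν,
    show ν + 2 = ν + 1 + 1 by ring, Real.rpow_add_one h2, Real.rpow_add_one h2]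
  field_simp
  ring

theorem hasDerivAt_besselJ (ν : ℝ) {x : ℝ} (hx : 0 < x) :
    HasDerivAt (besselJ ν) (ν / x * besselJ ν x - besselJ (ν + 1) x) x := by
  have h2 : x / 2 ≠ 0 := by positivity
  have h1 : HasDerivAt (fun x : ℝ => (x / 2) ^ ν) (1 / 2 * ν * (x / 2) ^ (ν - 1)) x :=
    ((hasDerivAt_id x).div_const 2).rpow_const (Or.inl h2)
  have h3 : HasDerivAt (fun x : ℝ => -(x ^ 2 / 4)) (-(x / 2)) x := by
    refine (((hasDerivAt_pow 2 x).div_const 4).neg).congr_deriv ?_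
    norm_num
    ring
  refine (h1.mul ((hasDerivAt_besselSeries ν _).comp x h3)).congr_deriv ?_
  rw [besselJ_eq, besselJ_eq, Real.rpow_add_one h2, Real.rpow_sub_one h2]
  simp only [Function.comp]
  field_simp
  ring

theorem isBesselPair_besselJ (ν : ℝ) : IsBesselPair ν (besselJ ν) (besselJ (ν + 1)) where
  left x hx := hasDerivAt_besselJ ν hx
  right x hx := by
    refine (hasDerivAt_besselJ (ν + 1) hx).congr_deriv ?_
    have := besselJ_add_besselJ_add_two ν hx
    rw [add_assoc, one_add_one_eq_two]
    have h2 : 2 * (ν + 1) / x * besselJ (ν + 1) x = 2 * ((ν + 1) / x * besselJ (ν + 1) x) := by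
      ring
    linarith

/-- The second solution of the Bessel system of order `ν`. -/
theorem isBesselPair_besselJ_neg (ν : ℝ) :
    IsBesselPair ν (besselJ (-ν)) (-besselJ (-ν - 1)) where
  left x hx := by
    -- The pair of order -ν - 1 solves the system of order ν once its members are exchanged and one
    -- sign is changed.
    refine ((isBesselPair_besselJ (-ν - 1)).right x hx |> fun h => ?_)
    rw [sub_add_cancel] at h
    refine h.congr_deriv ?_
    simp only [Pi.neg_apply]
    ring
  right x hx := by
    have h := ((isBesselPair_besselJ (-ν - 1)).left x hx).neg
    rw [sub_add_cancel] at h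
    refine h.congr_deriv ?_
    simp only [Pi.neg_apply]
    ring

theorem tendsto_rpow_mul_besselJ (ν : ℝ) :
    Tendsto (fun x => x ^ (-ν) * besselJ ν x) (𝓝[>] 0)
      (𝓝 ((2 : ℝ) ^ (-ν) * (Real.Gamma (ν + 1))⁻¹)) := by
  refine ((tendsto_besselSeries ν).const_mul ((2 : ℝ) ^ (-ν))).congr' ?_
  filter_upwards [self_mem_nhdsWithin] with x hx
  have hx0 : 0 < x := hx
  rw [besselJ_eq, Real.div_rpow hx0.le zero_le_two, Real.rpow_neg hx0.le,
    Real.rpow_neg zero_le_two]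
  have := (Real.rpow_pos_of_pos hx0 ν).ne'
  field_simp

theorem tendsto_rpow_mul_besselJ_of_lt {ν a : ℝ} (h : -ν < a) :
    Tendsto (fun x => x ^ a * besselJ ν x) (𝓝[>] 0) (𝓝 0) := by
  have h1 : Tendsto (fun x : ℝ => x ^ (a + ν)) (𝓝[>] 0) (𝓝 0) := by
    have := (Real.continuousAt_rpow_const (0 : ℝ) (a + ν) (Or.inr (by linarith))).tendsto
    rw [Real.zero_rpow (by linarith)] at this
    exact this.mono_left nhdsWithin_le_nhds
  have h2 := h1.mul (tendsto_rpow_mul_besselJ ν)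
  rw [zero_mul] at h2
  refine h2.congr' ?_
  filter_upwards [self_mem_nhdsWithin] with x hx
  rw [← mul_assoc, ← Real.rpow_add hx, add_neg_cancel_right]

/-- Near 0 the product is (x/2)^(2ν) times a factor tending to ν/Γ(ν+1)² > 0; monotonicity carries
the sign up to ν. -/
theorem besselJ_mul_euler_pos {ν : ℝ} (hν : 0 < ν) {x : ℝ} (hx : x ∈ Ioc 0 ν) :
    0 < besselJ ν x * (ν * besselJ ν x - x * besselJ (ν + 1) x) := by
  have hG : 0 < (Real.Gamma (ν + 1))⁻¹ := inv_pos.mpr (Real.Gamma_pos_of_pos (by linarith))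
  have hid : Tendsto (fun x : ℝ => x ^ 2 / 2) (𝓝[>] 0) (𝓝 0) := by
    have : Continuous fun x : ℝ => x ^ 2 / 2 := by fun_prop
    have h := this.tendsto 0
    norm_num at h
    exact h.mono_left nhdsWithin_le_nhds
  have hlim := (tendsto_besselSeries ν).mul (((tendsto_besselSeries ν).const_mul ν).sub
    (hid.mul (tendsto_besselSeries (ν + 1))))
  rw [zero_mul, sub_zero] at hlim
  have hev := hlim.eventually (lt_mem_nhds (by positivity))
  obtain ⟨t, ht, ht0, htx⟩ := (hev.and (Ioo_mem_nhdsGT hx.1)).exists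
  have h2 : t / 2 ≠ 0 := by positivity
  have hpos : 0 < besselJ ν t * (ν * besselJ ν t - t * besselJ (ν + 1) t) := by
    have hp : 0 < (t / 2) ^ ν := by positivity
    have heq : besselJ ν t * (ν * besselJ ν t - t * besselJ (ν + 1) t) =
        ((t / 2) ^ ν) ^ 2 * (besselSeries ν (-(t ^ 2 / 4)) *
          (ν * besselSeries ν (-(t ^ 2 / 4)) -
            t ^ 2 / 2 * besselSeries (ν + 1) (-(t ^ 2 / 4)))) := by
      rw [besselJ_eq, besselJ_eq, Real.rpow_add_one h2]
      ring
    rw [heq]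
    positivity
  exact hpos.trans_le ((isBesselPair_besselJ ν).monotoneOn_mul_euler
    ⟨ht0, htx.le.trans hx.2⟩ hx htx.le)

/-! ### Schläfli integrals -/

/-- The integral of `exp (ν t - x sinh t)` over the positive half-line. -/
noncomputable def schlafliTail (ν x : ℝ) : ℝ := ∫ t in Ioi 0, Real.exp (ν * t - x * Real.sinh t)

/-- The integral of `cos (ν θ - x sin θ + α)` over `[0, π]`. -/
noncomputable def schlafliArc (α ν x : ℝ) : ℝ :=
  ∫ θ in (0 : ℝ)..Real.pi, Real.cos (ν * θ - x * Real.sin θ + α)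

theorem sq_div_four_le_sinh {t : ℝ} (ht : 0 ≤ t) : t ^ 2 / 4 ≤ Real.sinh t := by
  have h1 := Real.quadratic_le_exp_of_nonneg ht
  have h2 : Real.exp (-t) ≤ 1 := Real.exp_le_one_iff.mpr (by linarith)
  rw [Real.sinh_eq]
  linarith

/-- From sinh t ≥ t²/4, by completing the square in t. -/
theorem exp_sub_sinh_le (ν : ℝ) {x t : ℝ} (hx : 0 < x) (ht : 0 ≤ t) :
    Real.exp (ν * t - x * Real.sinh t) ≤ Real.exp ((ν + 1) ^ 2 / x) * Real.exp (-t) := by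
  rw [← Real.exp_add, Real.exp_le_exp]
  have h1 := mul_le_mul_of_nonneg_left (sq_div_four_le_sinh ht) hx.le
  have h2 : (ν + 1) ^ 2 / x - (ν + 1) * t + x * (t ^ 2 / 4) =
      x / 4 * (t - 2 * (ν + 1) / x) ^ 2 := by
    field_simp
    ring
  have h3 : 0 ≤ x / 4 * (t - 2 * (ν + 1) / x) ^ 2 := by positivity
  linarith

theorem integrableOn_exp_sub_sinh (ν : ℝ) {x : ℝ} (hx : 0 < x) :
    IntegrableOn (fun t => Real.exp (ν * t - x * Real.sinh t)) (Ioi 0) := by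
  refine Integrable.mono' ((integrableOn_exp_neg_Ioi 0).const_mul (Real.exp ((ν + 1) ^ 2 / x)))
    (by fun_prop) ?_
  filter_upwards [ae_restrict_mem measurableSet_Ioi] with t ht
  rw [Real.norm_eq_abs, abs_of_pos (Real.exp_pos _)]
  exact exp_sub_sinh_le ν hx (le_of_lt ht)

theorem tendsto_exp_sub_sinh (ν : ℝ) {x : ℝ} (hx : 0 < x) :
    Tendsto (fun t => Real.exp (ν * t - x * Real.sinh t)) atTop (𝓝 0) := by
  have h := (Real.tendsto_exp_neg_atTop_nhds_zero).const_mul (Real.exp ((ν + 1) ^ 2 / x))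
  rw [mul_zero] at h
  refine squeeze_zero' (Eventually.of_forall fun t => (Real.exp_pos _).le) ?_ h
  filter_upwards [eventually_ge_atTop 0] with t ht using exp_sub_sinh_le ν hx ht

theorem exp_sub_sinh_mul_sinh (ν x t : ℝ) :
    Real.sinh t * Real.exp (ν * t - x * Real.sinh t) =
      (Real.exp ((ν + 1) * t - x * Real.sinh t) -
        Real.exp ((ν - 1) * t - x * Real.sinh t)) / 2 := by
  rw [show (ν + 1) * t - x * Real.sinh t = t + (ν * t - x * Real.sinh t) by ring,
    show (ν - 1) * t - x * Real.sinh t = -t + (ν * t - x * Real.sinh t) by ring,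
    Real.exp_add, Real.exp_add, Real.sinh_eq]
  ring

theorem exp_sub_sinh_mul_cosh (ν x t : ℝ) :
    Real.cosh t * Real.exp (ν * t - x * Real.sinh t) =
      (Real.exp ((ν + 1) * t - x * Real.sinh t) +
        Real.exp ((ν - 1) * t - x * Real.sinh t)) / 2 := by
  rw [show (ν + 1) * t - x * Real.sinh t = t + (ν * t - x * Real.sinh t) by ring,
    show (ν - 1) * t - x * Real.sinh t = -t + (ν * t - x * Real.sinh t) by ring,
    Real.exp_add, Real.exp_add, Real.cosh_eq]
  ring

theorem integrableOn_sinh_mul_exp_sub_sinh (ν : ℝ) {x : ℝ} (hx : 0 < x) :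
    IntegrableOn (fun t => Real.sinh t * Real.exp (ν * t - x * Real.sinh t)) (Ioi 0) := by
  simp only [exp_sub_sinh_mul_sinh]
  exact ((integrableOn_exp_sub_sinh (ν + 1) hx).sub
    (integrableOn_exp_sub_sinh (ν - 1) hx)).div_const 2

/-- Integrating the derivative of exp(ν t - x sinh t) leaves the boundary term -1. In `schlafliJ`
and `schlafliY` such terms cancel those of `schlafliArc_recurrence`. -/
theorem schlafliTail_recurrence (ν : ℝ) {x : ℝ} (hx : 0 < x) :
    ν * schlafliTail ν x - x / 2 * (schlafliTail (ν + 1) x + schlafliTail (ν - 1) x) = -1 := by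
  have hd : ∀ t ∈ Ici (0 : ℝ), HasDerivAt (fun t => Real.exp (ν * t - x * Real.sinh t))
      (ν * Real.exp (ν * t - x * Real.sinh t) -
        x / 2 * (Real.exp ((ν + 1) * t - x * Real.sinh t) +
          Real.exp ((ν - 1) * t - x * Real.sinh t))) t := by
    intro t _
    refine ((((hasDerivAt_id t).const_mul ν).sub
      ((Real.hasDerivAt_sinh t).const_mul x)).exp).congr_deriv ?_
    have := exp_sub_sinh_mul_cosh ν x t
    simp only [id, Pi.sub_apply]
    linear_combination -x * this
  have h1 := integrableOn_exp_sub_sinh ν hx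
  have h2 := integrableOn_exp_sub_sinh (ν + 1) hx
  have h3 := integrableOn_exp_sub_sinh (ν - 1) hx
  have h4 : IntegrableOn (fun t => Real.exp ((ν + 1) * t - x * Real.sinh t) +
      Real.exp ((ν - 1) * t - x * Real.sinh t)) (Ioi 0) := h2.add h3
  have := integral_Ioi_of_hasDerivAt_of_tendsto' hd
    ((h1.const_mul ν).sub (h4.const_mul (x / 2))) (tendsto_exp_sub_sinh ν hx)
  rw [integral_sub (h1.const_mul ν) (h4.const_mul (x / 2)), integral_const_mul,
    integral_const_mul, integral_add h2 h3] at this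
  simpa [schlafliTail] using this

theorem hasDerivAt_schlafliTail' (ν : ℝ) {x : ℝ} (hx : 0 < x) :
    HasDerivAt (schlafliTail ν)
      (-∫ t in Ioi 0, Real.sinh t * Real.exp (ν * t - x * Real.sinh t)) x := by
  have h := (hasDerivAt_integral_of_dominated_loc_of_deriv_le
    -- Keeping the parameter above x/2 makes the integrand at x/2 a common bound.
    (μ := volume.restrict (Ioi (0 : ℝ))) (s := Ioi (x / 2)) (x₀ := x)
    (F := fun x t => Real.exp (ν * t - x * Real.sinh t))
    (F' := fun x t => -(Real.sinh t * Real.exp (ν * t - x * Real.sinh t)))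
    (bound := fun t => Real.sinh t * Real.exp (ν * t - x / 2 * Real.sinh t))
    (Ioi_mem_nhds (by linarith)) (Eventually.of_forall fun y => by fun_prop)
    (integrableOn_exp_sub_sinh ν hx) (by fun_prop) ?_
    (integrableOn_sinh_mul_exp_sub_sinh ν (half_pos hx)) ?_).2
  · rw [integral_neg] at h
    exact h
  · filter_upwards [ae_restrict_mem measurableSet_Ioi] with t ht y hy
    have hs : 0 ≤ Real.sinh t := Real.sinh_nonneg_iff.mpr (le_of_lt ht)
    rw [norm_neg, Real.norm_eq_abs, abs_of_nonneg (by positivity)]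
    have : x / 2 ≤ y := le_of_lt hy
    gcongr
  · refine Eventually.of_forall fun t y _ => ?_
    refine ((((hasDerivAt_id y).mul_const (Real.sinh t)).const_sub (ν * t)).exp).congr_deriv ?_
    simp only [id]
    ring

theorem hasDerivAt_schlafliTail (ν : ℝ) {x : ℝ} (hx : 0 < x) :
    HasDerivAt (schlafliTail ν) ((schlafliTail (ν - 1) x - schlafliTail (ν + 1) x) / 2) x := by
  refine (hasDerivAt_schlafliTail' ν hx).congr_deriv ?_
  simp only [exp_sub_sinh_mul_sinh]
  rw [integral_div, integral_sub (integrableOn_exp_sub_sinh (ν + 1) hx)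
    (integrableOn_exp_sub_sinh (ν - 1) hx), schlafliTail, schlafliTail]
  ring

theorem continuous_schlafliTail {x : ℝ} (hx : 0 < x) :
    Continuous fun ν => schlafliTail ν x := by
  refine continuous_iff_continuousAt.mpr fun ν => ?_
  refine continuousAt_of_dominated (bound := fun t => Real.exp ((ν + 1) * t - x * Real.sinh t))
    (Eventually.of_forall fun y => by fun_prop) ?_ (integrableOn_exp_sub_sinh (ν + 1) hx)
    (Eventually.of_forall fun t => by fun_prop)
  filter_upwards [Iio_mem_nhds (show ν < ν + 1 by linarith)] with y hy
  filter_upwards [ae_restrict_mem measurableSet_Ioi] with t ht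
  have ht0 : 0 ≤ t := le_of_lt ht
  have hy' : y ≤ ν + 1 := le_of_lt hy
  rw [Real.norm_eq_abs, abs_of_pos (Real.exp_pos _)]
  gcongr

theorem schlafliTail_nonneg (ν x : ℝ) : 0 ≤ schlafliTail ν x :=
  integral_nonneg fun _ => (Real.exp_pos _).le

/-- The neighbouring tails in the recurrence are nonnegative. The bound is uniform in x, as needed
for the limit at 0. -/
theorem schlafliTail_neg_le {ν x : ℝ} (hν : 0 < ν) (hx : 0 < x) :
    schlafliTail (-ν) x ≤ 1 / ν := by
  have hrec := schlafliTail_recurrence (-ν) hx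
  have h1 := schlafliTail_nonneg (-ν + 1) x
  have h2 := schlafliTail_nonneg (-ν - 1) x
  rw [le_div_iff₀ hν]
  have : 0 ≤ x / 2 * (schlafliTail (-ν + 1) x + schlafliTail (-ν - 1) x) := by positivity
  linarith

theorem schlafliTail_neg_lt {ν x : ℝ} (hν : 0 < ν) (hx : 0 < x) :
    schlafliTail (-ν) x < schlafliTail ν x := by
  have h1 := integrableOn_exp_sub_sinh ν hx
  have h2 := integrableOn_exp_sub_sinh (-ν) hx
  have hlt : ∀ t ∈ Ioi (0 : ℝ), 0 < Real.exp (ν * t - x * Real.sinh t) -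
      Real.exp (-ν * t - x * Real.sinh t) := by
    intro t ht
    rw [sub_pos, Real.exp_lt_exp]
    nlinarith [mul_pos hν (mem_Ioi.mp ht)]
  have h : 0 < ∫ t in Ioi 0, (Real.exp (ν * t - x * Real.sinh t) -
      Real.exp (-ν * t - x * Real.sinh t)) := by
    have h3 : IntegrableOn (fun t => Real.exp (ν * t - x * Real.sinh t) -
        Real.exp (-ν * t - x * Real.sinh t)) (Ioi 0) := h1.sub h2
    rw [setIntegral_pos_iff_support_of_nonneg_ae ?_ h3]
    · have : Ioi (0 : ℝ) ⊆ (Function.support fun t => Real.exp (ν * t - x * Real.sinh t) -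
          Real.exp (-ν * t - x * Real.sinh t)) ∩ Ioi 0 := fun t ht => ⟨(hlt t ht).ne', ht⟩
      refine lt_of_lt_of_le ?_ (measure_mono this)
      simp
    · filter_upwards [ae_restrict_mem measurableSet_Ioi] with t ht using (hlt t ht).le
  rw [integral_sub h1 h2] at h
  exact sub_pos.mp h

theorem schlafliArc_recurrence (α ν x : ℝ) :
    ν * schlafliArc α ν x - x / 2 * (schlafliArc α (ν + 1) x + schlafliArc α (ν - 1) x) =
      Real.sin (ν * Real.pi + α) - Real.sin α := by
  have hd : ∀ θ ∈ uIcc 0 Real.pi,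
      HasDerivAt (fun θ => Real.sin (ν * θ - x * Real.sin θ + α))
      (ν * Real.cos (ν * θ - x * Real.sin θ + α) -
        x / 2 * (Real.cos ((ν + 1) * θ - x * Real.sin θ + α) +
          Real.cos ((ν - 1) * θ - x * Real.sin θ + α))) θ := by
    intro θ _
    refine (((((hasDerivAt_id θ).const_mul ν).sub
      ((Real.hasDerivAt_sin θ).const_mul x)).add_const α).sin).congr_deriv ?_
    rw [show (ν + 1) * θ - x * Real.sin θ + α = (ν * θ - x * Real.sin θ + α) + θ by ring,
      show (ν - 1) * θ - x * Real.sin θ + α = (ν * θ - x * Real.sin θ + α) - θ by ring,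
      Real.cos_add _ θ, Real.cos_sub _ θ]
    simp only [id, Pi.sub_apply]
    ring
  have := intervalIntegral.integral_eq_sub_of_hasDerivAt hd
    (Continuous.intervalIntegrable (by fun_prop) _ _)
  rw [intervalIntegral.integral_sub (Continuous.intervalIntegrable (by fun_prop) _ _)
    (Continuous.intervalIntegrable (by fun_prop) _ _), intervalIntegral.integral_const_mul,
    intervalIntegral.integral_const_mul,
    intervalIntegral.integral_add (Continuous.intervalIntegrable (by fun_prop) _ _)
    (Continuous.intervalIntegrable (by fun_prop) _ _)] at this
  simpa [schlafliArc] using this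

theorem hasDerivAt_schlafliArc' (α ν x : ℝ) :
    HasDerivAt (schlafliArc α ν)
      (∫ θ in (0 : ℝ)..Real.pi, Real.sin θ * Real.sin (ν * θ - x * Real.sin θ + α)) x := by
  refine (intervalIntegral.hasDerivAt_integral_of_dominated_loc_of_deriv_le
    (μ := volume) (s := univ) (x₀ := x) (a := 0) (b := Real.pi)
    (F := fun x θ => Real.cos (ν * θ - x * Real.sin θ + α))
    (F' := fun x θ => Real.sin θ * Real.sin (ν * θ - x * Real.sin θ + α))
    (bound := fun _ => 1) univ_mem (Eventually.of_forall fun y => by fun_prop)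
    (Continuous.intervalIntegrable (by fun_prop) _ _) (by fun_prop) ?_
    (Continuous.intervalIntegrable (by fun_prop) _ _) ?_).2
  · refine Eventually.of_forall fun θ _ y _ => ?_
    rw [norm_mul, Real.norm_eq_abs, Real.norm_eq_abs]
    exact mul_le_one₀ (Real.abs_sin_le_one _) (abs_nonneg _) (Real.abs_sin_le_one _)
  · refine Eventually.of_forall fun θ _ y _ => ?_
    refine (((((hasDerivAt_id y).mul_const (Real.sin θ)).const_sub (ν * θ)).add_const
      α).cos).congr_deriv ?_
    simp only [id]
    ring

theorem hasDerivAt_schlafliArc (α ν x : ℝ) :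
    HasDerivAt (schlafliArc α ν) ((schlafliArc α (ν - 1) x - schlafliArc α (ν + 1) x) / 2) x := by
  refine (hasDerivAt_schlafliArc' α ν x).congr_deriv ?_
  rw [schlafliArc, schlafliArc,
    ← intervalIntegral.integral_sub (Continuous.intervalIntegrable (by fun_prop) _ _)
      (Continuous.intervalIntegrable (by fun_prop) _ _), ← intervalIntegral.integral_div]
  refine intervalIntegral.integral_congr fun θ _ => ?_
  rw [show (ν + 1) * θ - x * Real.sin θ + α = (ν * θ - x * Real.sin θ + α) + θ by ring,
    show (ν - 1) * θ - x * Real.sin θ + α = (ν * θ - x * Real.sin θ + α) - θ by ring,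
    Real.cos_add _ θ, Real.cos_sub _ θ]
  ring

theorem continuous_schlafliArc (α x : ℝ) : Continuous fun ν => schlafliArc α ν x :=
  intervalIntegral.continuous_parametric_intervalIntegral_of_continuous' (by fun_prop) _ _

theorem abs_schlafliArc_le (α ν x : ℝ) : |schlafliArc α ν x| ≤ Real.pi := by
  have := intervalIntegral.norm_integral_le_of_norm_le_const (a := 0) (b := Real.pi) (C := 1)
    (f := fun θ => Real.cos (ν * θ - x * Real.sin θ + α)) fun θ _ => Real.abs_cos_le_one _
  rwa [sub_zero, abs_of_pos Real.pi_pos, one_mul] at this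

/-- The Schläfli integral for the Bessel function of the first kind. -/
noncomputable def schlafliJ (ν x : ℝ) : ℝ :=
  (schlafliArc 0 ν x - Real.sin (ν * Real.pi) * schlafliTail (-ν) x) / Real.pi

/-- The Schläfli integral for the Bessel function of the second kind. -/
noncomputable def schlafliY (ν x : ℝ) : ℝ :=
  (schlafliArc (Real.pi / 2) ν x - schlafliTail ν x -
    Real.cos (ν * Real.pi) * schlafliTail (-ν) x) / Real.pi

theorem isBesselPair_of_recurrence {C : ℝ → ℝ → ℝ}
    (hd : ∀ ν x, 0 < x → HasDerivAt (C ν) ((C (ν - 1) x - C (ν + 1) x) / 2) x)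
    (hr : ∀ ν x, 0 < x → ν * C ν x = x / 2 * (C (ν + 1) x + C (ν - 1) x)) (ν : ℝ) :
    IsBesselPair ν (C ν) (C (ν + 1)) where
  left x hx := by
    refine (hd ν x hx).congr_deriv ?_
    rw [div_mul_eq_mul_div, hr ν x hx]
    field_simp
    ring
  right x hx := by
    refine (hd (ν + 1) x hx).congr_deriv ?_
    rw [div_mul_eq_mul_div, hr (ν + 1) x hx, add_sub_cancel_right]
    field_simp
    ring

theorem sin_add_one_mul_pi (ν : ℝ) : Real.sin ((ν + 1) * Real.pi) = -Real.sin (ν * Real.pi) := by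
  rw [add_mul, one_mul, Real.sin_add_pi]

theorem sin_sub_one_mul_pi (ν : ℝ) : Real.sin ((ν - 1) * Real.pi) = -Real.sin (ν * Real.pi) := by
  rw [sub_mul, one_mul, Real.sin_sub_pi]

theorem cos_add_one_mul_pi (ν : ℝ) : Real.cos ((ν + 1) * Real.pi) = -Real.cos (ν * Real.pi) := by
  rw [add_mul, one_mul, Real.cos_add_pi]

theorem cos_sub_one_mul_pi (ν : ℝ) : Real.cos ((ν - 1) * Real.pi) = -Real.cos (ν * Real.pi) := by
  rw [sub_mul, one_mul, Real.cos_sub_pi]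

theorem schlafliJ_recurrence (ν : ℝ) {x : ℝ} (hx : 0 < x) :
    ν * schlafliJ ν x = x / 2 * (schlafliJ (ν + 1) x + schlafliJ (ν - 1) x) := by
  have h1 := schlafliArc_recurrence 0 ν x
  have h2 := schlafliTail_recurrence (-ν) hx
  rw [add_zero, Real.sin_zero, sub_zero] at h1
  simp only [schlafliJ, sin_add_one_mul_pi, sin_sub_one_mul_pi]
  rw [show -(ν + 1) = -ν - 1 by ring, show -(ν - 1) = -ν + 1 by ring]
  field_simp
  linear_combination 2 * h1 + 2 * Real.sin (ν * Real.pi) * h2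

theorem schlafliY_recurrence (ν : ℝ) {x : ℝ} (hx : 0 < x) :
    ν * schlafliY ν x = x / 2 * (schlafliY (ν + 1) x + schlafliY (ν - 1) x) := by
  have h1 := schlafliArc_recurrence (Real.pi / 2) ν x
  have h2 := schlafliTail_recurrence (-ν) hx
  have h3 := schlafliTail_recurrence ν hx
  rw [Real.sin_add_pi_div_two, Real.sin_pi_div_two] at h1
  simp only [schlafliY, cos_add_one_mul_pi, cos_sub_one_mul_pi]
  rw [show -(ν + 1) = -ν - 1 by ring, show -(ν - 1) = -ν + 1 by ring]
  field_simp
  linear_combination 2 * h1 + 2 * Real.cos (ν * Real.pi) * h2 - 2 * h3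

theorem isBesselPair_schlafliJ (ν : ℝ) : IsBesselPair ν (schlafliJ ν) (schlafliJ (ν + 1)) := by
  refine isBesselPair_of_recurrence (fun ν x hx => ?_)
    (fun ν x hx => schlafliJ_recurrence ν hx) ν
  refine (((hasDerivAt_schlafliArc 0 ν x).sub
    ((hasDerivAt_schlafliTail (-ν) hx).const_mul (Real.sin (ν * Real.pi)))).div_const
      Real.pi).congr_deriv ?_
  simp only [schlafliJ, sin_add_one_mul_pi, sin_sub_one_mul_pi]
  rw [show -(ν + 1) = -ν - 1 by ring, show -(ν - 1) = -ν + 1 by ring]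
  ring

theorem isBesselPair_schlafliY (ν : ℝ) : IsBesselPair ν (schlafliY ν) (schlafliY (ν + 1)) := by
  refine isBesselPair_of_recurrence (fun ν x hx => ?_)
    (fun ν x hx => schlafliY_recurrence ν hx) ν
  refine ((((hasDerivAt_schlafliArc (Real.pi / 2) ν x).sub (hasDerivAt_schlafliTail ν hx)).sub
    ((hasDerivAt_schlafliTail (-ν) hx).const_mul (Real.cos (ν * Real.pi)))).div_const
      Real.pi).congr_deriv ?_
  simp only [schlafliY, cos_add_one_mul_pi, cos_sub_one_mul_pi]
  rw [show -(ν + 1) = -ν - 1 by ring, show -(ν - 1) = -ν + 1 by ring]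
  ring

theorem continuous_schlafliY {x : ℝ} (hx : 0 < x) : Continuous fun ν => schlafliY ν x := by
  have h1 := continuous_schlafliTail hx
  have h2 := continuous_schlafliArc (Real.pi / 2) x
  have h3 : Continuous fun ν => schlafliTail (-ν) x := h1.comp continuous_neg
  unfold schlafliY
  fun_prop

/-- Substitute π - θ for θ and expand the cosine of a difference. -/
theorem schlafliArc_neg (ν x : ℝ) : schlafliArc 0 (-ν) x =
    Real.cos (ν * Real.pi) * schlafliArc 0 ν x -
      Real.sin (ν * Real.pi) * schlafliArc (Real.pi / 2) ν x := by
  have h : schlafliArc 0 (-ν) x = ∫ θ in (0 : ℝ)..Real.pi,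
      Real.cos (-ν * (Real.pi - θ) - x * Real.sin (Real.pi - θ) + 0) := by
    rw [intervalIntegral.integral_comp_sub_left
      (fun θ => Real.cos (-ν * θ - x * Real.sin θ + 0)) Real.pi]
    simp [schlafliArc]
  rw [h, schlafliArc, schlafliArc, ← intervalIntegral.integral_const_mul,
    ← intervalIntegral.integral_const_mul,
    ← intervalIntegral.integral_sub (Continuous.intervalIntegrable (by fun_prop) _ _)
      (Continuous.intervalIntegrable (by fun_prop) _ _)]
  refine intervalIntegral.integral_congr fun θ _ => ?_
  rw [Real.cos_add_pi_div_two, Real.sin_pi_sub,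
    show -ν * (Real.pi - θ) - x * Real.sin θ + 0 =
      (ν * θ - x * Real.sin θ) - ν * Real.pi by ring, Real.cos_sub _ (ν * Real.pi), add_zero]
  ring

theorem schlafliY_mul_sin (ν x : ℝ) : schlafliY ν x * Real.sin (ν * Real.pi) =
    schlafliJ ν x * Real.cos (ν * Real.pi) - schlafliJ (-ν) x := by
  have := schlafliArc_neg ν x
  rw [schlafliJ, schlafliJ, schlafliY, neg_neg, this, neg_mul, Real.sin_neg]
  field_simp
  ring

/-- The substitution s = (x/2) exp t. -/
theorem setIntegral_Ioi_rpow_mul_exp (β : ℝ) {x : ℝ} (hx : 0 < x) :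
    ∫ s in Ioi (x / 2), Real.exp (-s) * s ^ (β - 1) =
      (x / 2) ^ β * ∫ t in Ioi 0, Real.exp (β * t - x / 2 * Real.exp t) := by
  have himg : (fun t => x / 2 * Real.exp t) '' Ioi 0 = Ioi (x / 2) := by
    ext s
    simp only [mem_image, mem_Ioi]
    constructor
    · rintro ⟨t, ht, rfl⟩
      have := Real.one_lt_exp_iff.mpr ht
      nlinarith
    · intro hs
      have h1 : 1 < s / (x / 2) := (one_lt_div (half_pos hx)).mpr hs
      refine ⟨Real.log (s / (x / 2)), Real.log_pos h1, ?_⟩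
      rw [Real.exp_log (by linarith)]
      field_simp
  rw [← himg, integral_image_eq_integral_abs_deriv_smul measurableSet_Ioi
    (f' := fun t => x / 2 * Real.exp t)
    (fun t _ => ((Real.hasDerivAt_exp t).const_mul (x / 2)).hasDerivWithinAt)
    (fun a _ b _ h => Real.exp_injective (mul_left_cancel₀ (half_pos hx).ne' h)),
    ← integral_const_mul]
  refine setIntegral_congr_fun measurableSet_Ioi fun t _ => ?_
  have hpos : 0 < x / 2 * Real.exp t := by positivity
  simp only [smul_eq_mul]
  rw [abs_of_pos hpos, Real.rpow_sub_one hpos.ne', Real.mul_rpow (half_pos hx).le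
    (Real.exp_pos t).le, ← Real.exp_mul, sub_eq_add_neg, Real.exp_add, mul_comm β t]
  field_simp

/-- Replacing x sinh t by (x/2) exp t alters the integrand by a factor between 1 and exp(x/2), and
leaves a truncated Gamma integral. -/
theorem tendsto_rpow_mul_schlafliTail {β : ℝ} (hβ : 0 < β) :
    Tendsto (fun x => x ^ β * schlafliTail β x) (𝓝[>] 0) (𝓝 (2 ^ β * Real.Gamma β)) := by
  have hI : Tendsto (fun x : ℝ => ∫ s in Ioi (x / 2), Real.exp (-s) * s ^ (β - 1)) (𝓝[>] 0)
      (𝓝 (Real.Gamma β)) := by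
    have h0 : Tendsto (fun x : ℝ => x / 2) (𝓝[>] 0) (𝓝 0) := by
      have h : Continuous fun x : ℝ => x / 2 := by fun_prop
      have := h.tendsto 0
      rw [zero_div] at this
      exact this.mono_left nhdsWithin_le_nhds
    have := (aecover_Ioi_of_Ioi (μ := volume) h0).integral_tendsto_of_countably_generated
      (Real.GammaIntegral_convergent hβ)
    rw [← Real.Gamma_eq_integral hβ] at this
    refine this.congr' ?_
    filter_upwards [self_mem_nhdsWithin] with x hx
    rw [Measure.restrict_restrict measurableSet_Ioi,
      inter_eq_self_of_subset_left (Ioi_subset_Ioi (half_pos hx).le)]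
  have hE : Tendsto (fun x : ℝ => Real.exp (x / 2)) (𝓝[>] 0) (𝓝 1) := by
    have h : Continuous fun x : ℝ => Real.exp (x / 2) := by fun_prop
    have := h.tendsto 0
    rw [zero_div, Real.exp_zero] at this
    exact this.mono_left nhdsWithin_le_nhds
  have hlo := hI.const_mul ((2 : ℝ) ^ β)
  have hhi := hlo.mul hE
  rw [mul_one] at hhi
  have key : ∀ x ∈ Ioi (0 : ℝ),
      2 ^ β * (∫ s in Ioi (x / 2), Real.exp (-s) * s ^ (β - 1)) ≤ x ^ β * schlafliTail β x ∧
      x ^ β * schlafliTail β x ≤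
        2 ^ β * (∫ s in Ioi (x / 2), Real.exp (-s) * s ^ (β - 1)) * Real.exp (x / 2) := by
    intro x hx
    have hx0 : 0 < x := hx
    have hle : ∀ t ∈ Ioi (0 : ℝ), Real.exp (β * t - x / 2 * Real.exp t) ≤
        Real.exp (β * t - x * Real.sinh t) := by
      intro t _
      rw [Real.exp_le_exp, Real.sinh_eq]
      have : 0 ≤ x / 2 * Real.exp (-t) := by positivity
      linarith
    have hle' : ∀ t ∈ Ioi (0 : ℝ), Real.exp (β * t - x * Real.sinh t) ≤
        Real.exp (β * t - x / 2 * Real.exp t) * Real.exp (x / 2) := by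
      intro t ht
      rw [← Real.exp_add, Real.exp_le_exp, Real.sinh_eq]
      have h1 : Real.exp (-t) ≤ 1 := Real.exp_le_one_iff.mpr (neg_nonpos.mpr (le_of_lt ht))
      nlinarith
    have hint := integrableOn_exp_sub_sinh β hx0
    have hint' : IntegrableOn (fun t => Real.exp (β * t - x / 2 * Real.exp t)) (Ioi 0) := by
      refine Integrable.mono' hint (by fun_prop) ?_
      filter_upwards [ae_restrict_mem measurableSet_Ioi] with t ht
      rw [Real.norm_eq_abs, abs_of_pos (Real.exp_pos _)]
      exact hle t ht
    have h1 := setIntegral_mono_on hint' hint measurableSet_Ioi hle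
    have h2 := setIntegral_mono_on hint (hint'.mul_const _) measurableSet_Ioi hle'
    rw [integral_mul_const] at h2
    rw [setIntegral_Ioi_rpow_mul_exp β hx0, ← mul_assoc,
      ← Real.mul_rpow zero_le_two (half_pos hx0).le, mul_div_cancel₀ x two_ne_zero, mul_assoc]
    constructor <;> gcongr
    exacts [h1, h2]
  refine tendsto_of_tendsto_of_tendsto_of_le_of_le' hlo hhi ?_ ?_
  · filter_upwards [self_mem_nhdsWithin] with x hx using (key x hx).1
  · filter_upwards [self_mem_nhdsWithin] with x hx using (key x hx).2

/-! ### Signs of the function of the second kind and its derivative at `x = ν` -/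

/-- Equivalent to sin θ ≥ θ cos θ. For the phase φ = ν(θ - sin θ) it says φ ≤ θ φ', which controls
quotients by φ' near 0. -/
theorem sub_sin_le_mul {θ : ℝ} (h0 : 0 ≤ θ) (hπ : θ ≤ Real.pi) :
    θ - Real.sin θ ≤ θ * (1 - Real.cos θ) := by
  have hd : ∀ t : ℝ, HasDerivAt (fun t => Real.sin t - t * Real.cos t) (t * Real.sin t) t := by
    intro t
    refine ((Real.hasDerivAt_sin t).sub
      ((hasDerivAt_id t).mul (Real.hasDerivAt_cos t))).congr_deriv ?_
    simp only [id]
    ring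
  have hm : MonotoneOn (fun t => Real.sin t - t * Real.cos t) (Icc 0 Real.pi) := by
    refine monotoneOn_of_deriv_nonneg (convex_Icc _ _)
      (fun t _ => (hd t).continuousAt.continuousWithinAt)
      (fun t _ => (hd t).differentiableAt.differentiableWithinAt) fun t ht => ?_
    have ht' := interior_subset ht
    rw [(hd t).deriv]
    exact mul_nonneg ht'.1 (Real.sin_nonneg_of_mem_Icc ht')
  have := hm (left_mem_Icc.mpr Real.pi_pos.le) ⟨h0, hπ⟩ h0
  simp only [Real.sin_zero, zero_mul, sub_zero] at this
  linarith

theorem one_sub_cos_pos {θ : ℝ} (h0 : 0 < θ) (hπ : θ ≤ Real.pi) : 0 < 1 - Real.cos θ := by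
  have := Real.cos_lt_cos_of_nonneg_of_le_pi le_rfl hπ h0
  rw [Real.cos_zero] at this
  linarith

/-- If `M` vanishes to first order at `0`, is nonnegative at `π` and has derivative at most `k`
on `(0, π)`, then `k` has nonnegative integral. -/
theorem intervalIntegral_nonneg_of_deriv_le {M M' k : ℝ → ℝ} {c : ℝ} (hk : Continuous k)
    (hM0 : ∀ θ ∈ Icc 0 Real.pi, |M θ| ≤ c * θ) (hMπ : 0 ≤ M Real.pi)
    (hd : ∀ θ ∈ Ioc 0 Real.pi, HasDerivAt M (M' θ) θ) (hle : ∀ θ ∈ Ioo 0 Real.pi, M' θ ≤ k θ) :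
    0 ≤ ∫ θ in (0 : ℝ)..Real.pi, k θ := by
  have h00 : M 0 = 0 := by
    have := hM0 0 (left_mem_Icc.mpr Real.pi_pos.le)
    rwa [mul_zero, abs_nonpos_iff] at this
  have hcont : ContinuousOn M (Icc 0 Real.pi) := by
    intro θ hθ
    rcases hθ.1.eq_or_lt with rfl | hpos
    · rw [ContinuousWithinAt, h00]
      refine squeeze_zero_norm' (a := fun θ => c * θ) ?_ ?_
      · filter_upwards [self_mem_nhdsWithin] with t ht using hM0 t ht
      · have h : Continuous fun θ : ℝ => c * θ := by fun_prop
        have := h.tendsto 0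
        rw [mul_zero] at this
        exact this.mono_left nhdsWithin_le_nhds
    · exact (hd θ ⟨hpos, hθ.2⟩).continuousAt.continuousWithinAt
  have := intervalIntegral.sub_le_integral_of_hasDeriv_right_of_le Real.pi_pos.le hcont
    (fun θ hθ => (hd θ (Ioo_subset_Ioc_self hθ)).hasDerivWithinAt)
    (hk.integrableOn_Icc) hle
  rw [h00, sub_zero] at this
  exact hMπ.trans this

theorem one_sub_cos_le_sq (y : ℝ) : 1 - Real.cos y ≤ y ^ 2 / 2 := by
  have := Real.one_sub_sq_div_two_le_cos (x := y)
  linarith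

theorem hasDerivAt_one_sub_cos (ν θ : ℝ) :
    HasDerivAt (fun θ => 1 - Real.cos (ν * (θ - Real.sin θ)))
      (ν * (1 - Real.cos θ) * Real.sin (ν * (θ - Real.sin θ))) θ := by
  refine (((((hasDerivAt_id θ).sub (Real.hasDerivAt_sin θ)).const_mul ν).cos).const_sub
    1).congr_deriv ?_
  simp only [id, Pi.sub_apply]
  ring

theorem one_sub_cos_le {ν θ : ℝ} (h0 : 0 ≤ θ) (hπ : θ ≤ Real.pi) :
    1 - Real.cos (ν * (θ - Real.sin θ)) ≤ ν ^ 2 * θ ^ 2 * (1 - Real.cos θ) ^ 2 / 2 := by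
  refine (one_sub_cos_le_sq _).trans ?_
  have h1 := sub_sin_le_mul h0 hπ
  have h2 : 0 ≤ θ - Real.sin θ := sub_nonneg.mpr (Real.sin_le h0)
  have h3 := pow_le_pow_left₀ h2 h1 2
  rw [mul_pow]
  have := mul_le_mul_of_nonneg_left h3 (sq_nonneg ν)
  rw [mul_pow] at this
  linarith

/-- With φ = ν(θ - sin θ), take M = (1 - cos φ)/φ'. Then M' = sin φ - (1 - cos φ) φ''/φ'², and φ'' =
ν sin θ ≥ 0. At θ = 0 the quotient 0/0 has the value 0, which is also its limit. -/
theorem integral_sin_nonneg {ν : ℝ} (hν : 0 < ν) :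
    0 ≤ ∫ θ in (0 : ℝ)..Real.pi, Real.sin (ν * (θ - Real.sin θ)) := by
  refine intervalIntegral_nonneg_of_deriv_le
    (M := fun θ => (1 - Real.cos (ν * (θ - Real.sin θ))) / (ν * (1 - Real.cos θ)))
    (M' := fun θ => Real.sin (ν * (θ - Real.sin θ)) -
      (1 - Real.cos (ν * (θ - Real.sin θ))) * Real.sin θ / (ν * (1 - Real.cos θ) ^ 2))
    (c := ν * Real.pi) (by fun_prop) ?_ ?_ ?_ ?_
  · intro θ hθ
    have h1 : 0 ≤ 1 - Real.cos θ := sub_nonneg.mpr (Real.cos_le_one _)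
    have h2 : 0 ≤ 1 - Real.cos (ν * (θ - Real.sin θ)) := sub_nonneg.mpr (Real.cos_le_one _)
    rw [abs_of_nonneg (by positivity)]
    refine div_le_of_le_mul₀ (by positivity) (by have := hθ.1; positivity) ?_
    refine (one_sub_cos_le hθ.1 hθ.2).trans ?_
    have h3 : 1 - Real.cos θ ≤ 2 := by linarith [Real.neg_one_le_cos θ]
    have h4 : θ * ((1 - Real.cos θ) / 2) ≤ Real.pi * 1 :=
      mul_le_mul hθ.2 (by linarith) (by positivity) Real.pi_pos.le
    have h5 : 0 ≤ ν ^ 2 * θ * (1 - Real.cos θ) := by have := hθ.1; positivity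
    nlinarith [mul_le_mul_of_nonneg_left h4 h5]
  · have h1 : 0 ≤ 1 - Real.cos Real.pi := sub_nonneg.mpr (Real.cos_le_one _)
    have h2 : 0 ≤ 1 - Real.cos (ν * (Real.pi - Real.sin Real.pi)) :=
      sub_nonneg.mpr (Real.cos_le_one _)
    positivity
  · intro θ hθ
    have h1 := one_sub_cos_pos hθ.1 hθ.2
    refine ((hasDerivAt_one_sub_cos ν θ).div (((Real.hasDerivAt_cos θ).const_sub 1).const_mul ν)
      (by positivity)).congr_deriv ?_
    field_simp
  · intro θ hθ
    have h2 : 0 ≤ 1 - Real.cos (ν * (θ - Real.sin θ)) := sub_nonneg.mpr (Real.cos_le_one _)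
    have h3 : 0 ≤ Real.sin θ := (Real.sin_pos_of_mem_Ioo hθ).le
    rw [sub_le_self_iff]
    positivity

/-- Integrate by parts twice: (sin θ/φ')' = -1/φ', so the term sin φ/φ' that the first step leaves
is cancelled by the derivative of (1 - cos φ)/φ'², up to a remainder of known sign. -/
theorem integral_sin_mul_cos_nonneg {ν : ℝ} (hν : 0 < ν) :
    0 ≤ ∫ θ in (0 : ℝ)..Real.pi, Real.sin θ * Real.cos (ν * (θ - Real.sin θ)) := by
  refine intervalIntegral_nonneg_of_deriv_le
    (M := fun θ => Real.sin (ν * (θ - Real.sin θ)) * Real.sin θ / (ν * (1 - Real.cos θ)) +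
      (1 - Real.cos (ν * (θ - Real.sin θ))) / (ν * (1 - Real.cos θ)) ^ 2)
    (M' := fun θ => Real.sin θ * Real.cos (ν * (θ - Real.sin θ)) -
      2 * (1 - Real.cos (ν * (θ - Real.sin θ))) * Real.sin θ /
        (ν ^ 2 * (1 - Real.cos θ) ^ 3))
    (c := 1 + Real.pi) (by fun_prop) ?_ ?_ ?_ ?_
  · intro θ hθ
    have h1 : 0 ≤ 1 - Real.cos θ := sub_nonneg.mpr (Real.cos_le_one _)
    have h2 : 0 ≤ 1 - Real.cos (ν * (θ - Real.sin θ)) := sub_nonneg.mpr (Real.cos_le_one _)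
    have h3 : 0 ≤ θ - Real.sin θ := sub_nonneg.mpr (Real.sin_le hθ.1)
    have hθ0 := hθ.1
    rw [add_mul, one_mul]
    refine (abs_add_le _ _).trans (add_le_add ?_ ?_)
    · rw [abs_div, abs_mul, abs_of_nonneg (show 0 ≤ ν * (1 - Real.cos θ) by positivity)]
      refine div_le_of_le_mul₀ (by positivity) hθ.1 ?_
      have h4 : |Real.sin (ν * (θ - Real.sin θ))| ≤ ν * (θ * (1 - Real.cos θ)) := by
        refine Real.abs_sin_le_abs.trans ?_
        rw [abs_of_nonneg (by positivity)]
        exact mul_le_mul_of_nonneg_left (sub_sin_le_mul hθ.1 hθ.2) hν.le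
      calc |Real.sin (ν * (θ - Real.sin θ))| * |Real.sin θ|
          ≤ ν * (θ * (1 - Real.cos θ)) * 1 :=
            mul_le_mul h4 (Real.abs_sin_le_one _) (abs_nonneg _) (by positivity)
        _ = θ * (ν * (1 - Real.cos θ)) := by ring
    · rw [abs_of_nonneg (by positivity)]
      refine div_le_of_le_mul₀ (by positivity) (by positivity) ?_
      refine (one_sub_cos_le hθ.1 hθ.2).trans ?_
      have h4 := mul_le_mul_of_nonneg_right hθ.2 hθ0
      have h5 : 0 ≤ ν ^ 2 * (1 - Real.cos θ) ^ 2 := by positivity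
      have h6 := mul_le_mul_of_nonneg_left h4 h5
      have h7 : 0 ≤ ν ^ 2 * (1 - Real.cos θ) ^ 2 * (Real.pi * θ) := by positivity
      nlinarith
  · have h2 : 0 ≤ 1 - Real.cos (ν * (Real.pi - Real.sin Real.pi)) :=
      sub_nonneg.mpr (Real.cos_le_one _)
    simp only [Real.sin_pi, mul_zero, zero_div, zero_add] at h2 ⊢
    positivity
  · intro θ hθ
    have h1 := one_sub_cos_pos hθ.1 hθ.2
    have hsin : HasDerivAt (fun θ => Real.sin (ν * (θ - Real.sin θ)))
        (ν * (1 - Real.cos θ) * Real.cos (ν * (θ - Real.sin θ))) θ := by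
      refine ((((hasDerivAt_id θ).sub (Real.hasDerivAt_sin θ)).const_mul ν).sin).congr_deriv ?_
      simp only [id, Pi.sub_apply]
      ring
    have hden := ((Real.hasDerivAt_cos θ).const_sub 1).const_mul ν
    refine (((hsin.mul (Real.hasDerivAt_sin θ)).div hden (by positivity)).add
      ((hasDerivAt_one_sub_cos ν θ).div (hden.pow 2)
        (by simp only [Pi.pow_apply]; positivity))).congr_deriv ?_
    have hsq : Real.sin θ ^ 2 = (1 - Real.cos θ) * (1 + Real.cos θ) := by
      rw [Real.sin_sq]
      ring
    simp only [Pi.mul_apply, Pi.pow_apply]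
    field_simp
    push_cast
    linear_combination
      -(ν ^ 2 * (1 - Real.cos θ) ^ 2 * Real.sin (ν * (θ - Real.sin θ))) * hsq
  · intro θ hθ
    have h1 := one_sub_cos_pos hθ.1 hθ.2.le
    have h2 : 0 ≤ 1 - Real.cos (ν * (θ - Real.sin θ)) := sub_nonneg.mpr (Real.cos_le_one _)
    have h3 : 0 ≤ Real.sin θ := (Real.sin_pos_of_mem_Ioo hθ).le
    rw [sub_le_self_iff]
    positivity

/-- At x = ν the arc is minus the integral of sin φ, and the growing tail outweighs the decaying
one, whose coefficient is at most 1 in absolute value. -/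
theorem schlafliY_self_neg {ν : ℝ} (hν : 0 < ν) : schlafliY ν ν < 0 := by
  refine div_neg_of_neg_of_pos ?_ Real.pi_pos
  have h1 : schlafliArc (Real.pi / 2) ν ν =
      -∫ θ in (0 : ℝ)..Real.pi, Real.sin (ν * (θ - Real.sin θ)) := by
    rw [schlafliArc, ← intervalIntegral.integral_neg]
    refine intervalIntegral.integral_congr fun θ _ => ?_
    rw [Real.cos_add_pi_div_two, mul_sub]
  have h2 := schlafliTail_neg_lt hν hν
  have h3 := schlafliTail_nonneg (-ν) ν
  have h4 := Real.neg_one_le_cos (ν * Real.pi)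
  have h5 := integral_sin_nonneg hν
  nlinarith [mul_nonneg (neg_le_iff_add_nonneg.mp h4) h3]

theorem hasDerivAt_schlafliY' (ν : ℝ) {x : ℝ} (hx : 0 < x) :
    HasDerivAt (schlafliY ν)
      (((∫ θ in (0 : ℝ)..Real.pi, Real.sin θ * Real.cos (ν * θ - x * Real.sin θ)) +
        (∫ t in Ioi 0, Real.sinh t * Real.exp (ν * t - x * Real.sinh t)) +
        Real.cos (ν * Real.pi) *
          ∫ t in Ioi 0, Real.sinh t * Real.exp (-ν * t - x * Real.sinh t)) / Real.pi) x := by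
  refine ((((hasDerivAt_schlafliArc' (Real.pi / 2) ν x).sub (hasDerivAt_schlafliTail' ν hx)).sub
    ((hasDerivAt_schlafliTail' (-ν) hx).const_mul (Real.cos (ν * Real.pi)))).div_const
      Real.pi).congr_deriv ?_
  simp only [Real.sin_add_pi_div_two]
  ring

theorem deriv_schlafliY_self_pos {ν : ℝ} (hν : 0 < ν) : 0 < deriv (schlafliY ν) ν := by
  rw [(hasDerivAt_schlafliY' ν hν).deriv]
  refine div_pos ?_ Real.pi_pos
  have h1 := integral_sin_mul_cos_nonneg hν
  simp only [mul_sub] at h1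
  have hi1 := integrableOn_sinh_mul_exp_sub_sinh ν hν
  have hi2 := integrableOn_sinh_mul_exp_sub_sinh (-ν) hν
  have hlt : ∀ t ∈ Ioi (0 : ℝ), 0 < Real.sinh t * Real.exp (ν * t - ν * Real.sinh t) +
      Real.cos (ν * Real.pi) * (Real.sinh t * Real.exp (-ν * t - ν * Real.sinh t)) := by
    intro t ht
    have hs : 0 < Real.sinh t := Real.sinh_pos_iff.mpr ht
    have he : Real.exp (-ν * t - ν * Real.sinh t) < Real.exp (ν * t - ν * Real.sinh t) := by
      rw [Real.exp_lt_exp]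
      nlinarith [mul_pos hν (mem_Ioi.mp ht)]
    have hc := Real.neg_one_le_cos (ν * Real.pi)
    have hp : 0 < Real.sinh t * Real.exp (-ν * t - ν * Real.sinh t) := by positivity
    nlinarith [mul_pos hs (sub_pos.mpr he), mul_nonneg (neg_le_iff_add_nonneg.mp hc) hp.le]
  have hi3 : IntegrableOn (fun t => Real.sinh t * Real.exp (ν * t - ν * Real.sinh t) +
      Real.cos (ν * Real.pi) * (Real.sinh t * Real.exp (-ν * t - ν * Real.sinh t))) (Ioi 0) :=
    hi1.add (hi2.const_mul _)
  have h : 0 < ∫ t in Ioi 0, (Real.sinh t * Real.exp (ν * t - ν * Real.sinh t) +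
      Real.cos (ν * Real.pi) * (Real.sinh t * Real.exp (-ν * t - ν * Real.sinh t))) := by
    rw [setIntegral_pos_iff_support_of_nonneg_ae ?_ hi3]
    · have : Ioi (0 : ℝ) ⊆ (Function.support fun t =>
          Real.sinh t * Real.exp (ν * t - ν * Real.sinh t) + Real.cos (ν * Real.pi) *
            (Real.sinh t * Real.exp (-ν * t - ν * Real.sinh t))) ∩ Ioi 0 :=
        fun t ht => ⟨(hlt t ht).ne', ht⟩
      refine lt_of_lt_of_le ?_ (measure_mono this)
      simp
    · filter_upwards [ae_restrict_mem measurableSet_Ioi] with t ht using (hlt t ht).le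
  rw [integral_add hi1 (hi2.const_mul _), integral_const_mul] at h
  linarith

/-! ### The Schläfli integrals are the Bessel functions -/

theorem tendsto_rpow_nhdsGT_zero {a : ℝ} (ha : 0 < a) :
    Tendsto (fun x : ℝ => x ^ a) (𝓝[>] 0) (𝓝 0) := by
  have := (Real.continuousAt_rpow_const (0 : ℝ) a (Or.inr ha.le)).tendsto
  rw [Real.zero_rpow ha.ne'] at this
  exact this.mono_left nhdsWithin_le_nhds

theorem tendsto_rpow_mul_schlafliArc (α ν : ℝ) {a : ℝ} (ha : 0 < a) :
    Tendsto (fun x => x ^ a * schlafliArc α ν x) (𝓝[>] 0) (𝓝 0) := by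
  refine (tendsto_rpow_nhdsGT_zero ha).zero_mul_isBoundedUnder_le ?_
  exact isBoundedUnder_of ⟨Real.pi, fun x => abs_schlafliArc_le α ν x⟩

/-- The tail dominates at 0; Euler's reflection formula turns sin(νπ) Γ(-ν) into -π/Γ(ν+1). -/
theorem tendsto_rpow_mul_schlafliJ {ν : ℝ} (h1 : -1 < ν) (h0 : ν < 0) :
    Tendsto (fun x => x ^ (-ν) * schlafliJ ν x) (𝓝[>] 0)
      (𝓝 ((2 : ℝ) ^ (-ν) * (Real.Gamma (ν + 1))⁻¹)) := by
  have hA := tendsto_rpow_mul_schlafliArc 0 ν (neg_pos.mpr h0)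
  have hK := tendsto_rpow_mul_schlafliTail (neg_pos.mpr h0)
  have h := (hA.sub (hK.const_mul (Real.sin (ν * Real.pi)))).div_const Real.pi
  have hrefl := Real.Gamma_mul_Gamma_one_sub (-ν)
  rw [sub_neg_eq_add, add_comm 1 ν, mul_neg, Real.sin_neg, mul_comm Real.pi] at hrefl
  have hs : Real.sin (ν * Real.pi) < 0 := by
    apply Real.sin_neg_of_neg_of_neg_pi_lt
    · exact mul_neg_of_neg_of_pos h0 Real.pi_pos
    · nlinarith [Real.pi_pos]
  have hG : 0 < Real.Gamma (ν + 1) := Real.Gamma_pos_of_pos (by linarith)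
  have hlim : (0 - Real.sin (ν * Real.pi) * (2 ^ (-ν) * Real.Gamma (-ν))) / Real.pi =
      2 ^ (-ν) * (Real.Gamma (ν + 1))⁻¹ := by
    have hs' := hs.ne
    have hpi := Real.pi_pos.ne'
    rw [eq_div_iff (neg_ne_zero.mpr hs')] at hrefl
    field_simp
    linear_combination (2 : ℝ) ^ (-ν) * hrefl
  rw [hlim] at h
  refine h.congr fun x => ?_
  rw [schlafliJ]
  ring

theorem tendsto_rpow_mul_schlafliJ_of_pos {ν : ℝ} (h0 : 0 < ν) :
    Tendsto (fun x => x ^ ν * schlafliJ ν x) (𝓝[>] 0) (𝓝 0) := by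
  have hK : Tendsto (fun x => x ^ ν * schlafliTail (-ν) x) (𝓝[>] 0) (𝓝 0) := by
    refine (tendsto_rpow_nhdsGT_zero h0).zero_mul_isBoundedUnder_le ?_
    refine isBoundedUnder_of_eventually_le (a := 1 / ν) ?_
    filter_upwards [self_mem_nhdsWithin] with x hx
    simp only [Function.comp, Real.norm_eq_abs, abs_of_nonneg (schlafliTail_nonneg _ _)]
    exact schlafliTail_neg_le h0 hx
  have h := ((tendsto_rpow_mul_schlafliArc 0 ν h0).sub
    (hK.const_mul (Real.sin (ν * Real.pi)))).div_const Real.pi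
  rw [mul_zero, sub_zero, zero_div] at h
  refine h.congr fun x => ?_
  rw [schlafliJ]
  ring

theorem IsBesselPair.tendsto_wronskian {f g f₁ g₁ : ℝ → ℝ} {ν a b a₁ b₁ : ℝ}
    (hf : Tendsto (fun x => x ^ (-ν) * f x) (𝓝[>] 0) (𝓝 a))
    (hg : Tendsto (fun x => x ^ (ν + 1) * g x) (𝓝[>] 0) (𝓝 b))
    (hf₁ : Tendsto (fun x => x ^ (-ν) * f₁ x) (𝓝[>] 0) (𝓝 a₁))
    (hg₁ : Tendsto (fun x => x ^ (ν + 1) * g₁ x) (𝓝[>] 0) (𝓝 b₁)) :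
    Tendsto (fun x => x * (f x * g₁ x - g x * f₁ x)) (𝓝[>] 0) (𝓝 (a * b₁ - b * a₁)) := by
  refine ((hf.mul hg₁).sub (hg.mul hf₁)).congr' ?_
  filter_upwards [self_mem_nhdsWithin] with x hx
  have hx0 : 0 < x := hx
  have : x ^ (-ν) * x ^ (ν + 1) = x := by
    rw [← Real.rpow_add hx0, neg_add_cancel_left, Real.rpow_one]
  linear_combination (f x * g₁ x - g x * f₁ x) * this

/-- The difference of the two solutions has zero Wronskian with both J_ν and J_{-ν}, by the limits
at 0. These two are independent, so it vanishes. In this range of ν all the limits needed are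
available. -/
theorem schlafliJ_eq_besselJ_of_mem_Ioo {ν : ℝ} (h1 : -1 < ν) (h0 : ν < 0) {x : ℝ} (hx : 0 < x) :
    schlafliJ ν x = besselJ ν x ∧ schlafliJ (ν + 1) x = besselJ (ν + 1) x := by
  have hν1 : 0 < ν + 1 := by linarith
  have hJ := isBesselPair_besselJ ν
  have hN := isBesselPair_besselJ_neg ν
  have hD := (isBesselPair_schlafliJ ν).sub hJ
  have tJ := tendsto_rpow_mul_besselJ ν
  have tJ' := tendsto_rpow_mul_besselJ_of_lt (ν := ν + 1) (a := ν + 1) (by linarith)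
  have tN := tendsto_rpow_mul_besselJ_of_lt (ν := -ν) (a := -ν) (by linarith)
  have tN' := (tendsto_rpow_mul_besselJ (-ν - 1)).neg
  have tD : Tendsto (fun x => x ^ (-ν) * (schlafliJ ν - besselJ ν) x) (𝓝[>] 0) (𝓝 0) := by
    have := (tendsto_rpow_mul_schlafliJ h1 h0).sub tJ
    rw [sub_self] at this
    exact this.congr fun x => (mul_sub _ _ _).symm
  have tD' : Tendsto (fun x => x ^ (ν + 1) * (schlafliJ (ν + 1) - besselJ (ν + 1)) x)
      (𝓝[>] 0) (𝓝 0) := by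
    have := (tendsto_rpow_mul_schlafliJ_of_pos hν1).sub tJ'
    rw [sub_self] at this
    exact this.congr fun x => (mul_sub _ _ _).symm
  rw [show -(-ν - 1) = ν + 1 by ring, sub_add_cancel] at tN'
  replace tN' : Tendsto (fun x => x ^ (ν + 1) * (-besselJ (-ν - 1)) x) (𝓝[>] 0)
      (𝓝 (-(2 ^ (ν + 1) * (Real.Gamma (-ν))⁻¹))) := tN'.congr fun x => (mul_neg _ _).symm
  have w1 := hD.wronskian_eq_of_tendsto hJ (IsBesselPair.tendsto_wronskian tD tD' tJ tJ') hx
  have w2 := hD.wronskian_eq_of_tendsto hN (IsBesselPair.tendsto_wronskian tD tD' tN tN') hx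
  have w3 := hJ.wronskian_eq_of_tendsto hN (IsBesselPair.tendsto_wronskian tJ tJ' tN tN') hx
  have hne : besselJ ν x * (-besselJ (-ν - 1)) x - besselJ (ν + 1) x * besselJ (-ν) x ≠ 0 := by
    intro h
    rw [h, mul_zero, zero_mul, sub_zero, mul_neg, eq_comm, neg_eq_zero] at w3
    have hG1 : 0 < Real.Gamma (ν + 1) := Real.Gamma_pos_of_pos hν1
    have hG2 : 0 < Real.Gamma (-ν) := Real.Gamma_pos_of_pos (by linarith)
    have : (0 : ℝ) < 2 ^ (-ν) * (Real.Gamma (ν + 1))⁻¹ * (2 ^ (ν + 1) * (Real.Gamma (-ν))⁻¹) := by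
      positivity
    exact this.ne' w3
  simp only [zero_mul, sub_zero, mul_eq_zero, hx.ne', false_or] at w1 w2
  constructor
  · refine sub_eq_zero.mp ((mul_eq_zero.mp ?_).resolve_right hne)
    have e1 : schlafliJ ν x - besselJ ν x = (schlafliJ ν - besselJ ν) x := rfl
    rw [e1]
    linear_combination besselJ ν x * w2 - besselJ (-ν) x * w1
  · refine sub_eq_zero.mp ((mul_eq_zero.mp ?_).resolve_right hne)
    have e1 : schlafliJ (ν + 1) x - besselJ (ν + 1) x =
      (schlafliJ (ν + 1) - besselJ (ν + 1)) x := rfl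
    rw [e1]
    linear_combination besselJ (ν + 1) x * w2 - (-besselJ (-ν - 1)) x * w1

/-- Both sides obey the same three-term recurrence, which carries the equality by integer steps from
orders between -1 and 1. -/
theorem schlafliJ_eq_besselJ {ν : ℝ} (hν : ¬∃ n : ℤ, ν = n) {x : ℝ} (hx : 0 < x) :
    schlafliJ ν x = besselJ ν x := by
  have hfr : 0 < Int.fract ν := by
    rw [Int.fract_pos]
    exact fun h => hν ⟨_, h⟩
  have hbase := schlafliJ_eq_besselJ_of_mem_Ioo (ν := Int.fract ν - 1) (by linarith)
    (by linarith [Int.fract_lt_one ν]) hx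
  have hS : ∀ μ, schlafliJ μ x + schlafliJ (μ + 2) x = 2 * (μ + 1) / x * schlafliJ (μ + 1) x := by
    intro μ
    have := schlafliJ_recurrence (μ + 1) hx
    rw [add_sub_cancel_right, add_assoc, one_add_one_eq_two] at this
    field_simp
    linear_combination -2 * this
  have hJ := fun μ => besselJ_add_besselJ_add_two μ hx
  have key : ∀ n : ℤ, schlafliJ (Int.fract ν - 1 + n) x = besselJ (Int.fract ν - 1 + n) x ∧
      schlafliJ (Int.fract ν - 1 + n + 1) x = besselJ (Int.fract ν - 1 + n + 1) x := by
    intro n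
    induction n using Int.induction_on with
    | zero => simpa using hbase
    | succ n ih =>
      have h1 := hS (Int.fract ν - 1 + n)
      have h2 := hJ (Int.fract ν - 1 + n)
      push_cast at ih ⊢
      rw [show Int.fract ν - 1 + (n + 1 : ℝ) = Int.fract ν - 1 + n + 1 by ring,
        show Int.fract ν - 1 + n + 1 + 1 = Int.fract ν - 1 + n + 2 by ring]
      refine ⟨ih.2, ?_⟩
      rw [ih.1, ih.2] at h1
      linarith
    | pred n ih =>
      have h1 := hS (Int.fract ν - 1 + (-n - 1))
      have h2 := hJ (Int.fract ν - 1 + (-n - 1))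
      push_cast at ih ⊢
      rw [show Int.fract ν - 1 + (-n - 1 : ℝ) + 2 = Int.fract ν - 1 + -n + 1 by ring,
        show Int.fract ν - 1 + (-n - 1 : ℝ) + 1 = Int.fract ν - 1 + -n by ring] at *
      refine ⟨?_, ih.1⟩
      rw [ih.1, ih.2] at h1
      linarith
  have := (key ⌊ν⌋).2
  rwa [show Int.fract ν - 1 + ⌊ν⌋ + 1 = ν by rw [Int.fract]; ring] at this

theorem besselYQuot_eq_schlafliY {ν : ℝ} (hν : ¬∃ n : ℤ, ν = n) {x : ℝ} (hx : 0 < x) :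
    besselYQuot ν x = schlafliY ν x := by
  have hν' : ¬∃ n : ℤ, -ν = n := fun ⟨n, hn⟩ => hν ⟨-n, by push_cast; linarith⟩
  have hs : Real.sin (ν * Real.pi) ≠ 0 := fun h => by
    obtain ⟨n, hn⟩ := Real.sin_eq_zero_iff.mp h
    exact hν ⟨n, (mul_right_cancel₀ Real.pi_pos.ne' hn).symm⟩
  rw [besselYQuot, div_eq_iff hs, schlafliY_mul_sin, schlafliJ_eq_besselJ hν hx,
    schlafliJ_eq_besselJ hν' hx]

theorem besselY_eq_schlafliY (ν : ℝ) {x : ℝ} (hx : 0 < x) : besselY ν x = schlafliY ν x := by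
  rw [besselY]
  split_ifs with hν
  · obtain ⟨n, rfl⟩ := hν
    refine Tendsto.limUnder_eq ?_
    refine (((continuous_schlafliY hx).tendsto (n : ℝ)).mono_left nhdsWithin_le_nhds).congr' ?_
    -- No integer other than n lies within distance 1 of n, so the quotient formula holds on the
    -- punctured neighbourhood.
    have hU : Ioo ((n : ℝ) - 1) (n + 1) ∈ 𝓝 (n : ℝ) := Ioo_mem_nhds (by linarith) (by linarith)
    filter_upwards [mem_nhdsWithin_of_mem_nhds hU, self_mem_nhdsWithin] with μ hμ hne
    refine (besselYQuot_eq_schlafliY ?_ hx).symm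
    rintro ⟨m, rfl⟩
    refine hne ?_
    have h1 : n - 1 < m := by exact_mod_cast hμ.1
    have h2 : m < n + 1 := by exact_mod_cast hμ.2
    rw [mem_singleton_iff, show m = n by omega]
  · exact besselYQuot_eq_schlafliY hν hx

theorem isBesselPair_besselY (ν : ℝ) : IsBesselPair ν (besselY ν) (besselY (ν + 1)) where
  left x hx := by
    rw [besselY_eq_schlafliY ν hx, besselY_eq_schlafliY (ν + 1) hx]
    refine ((isBesselPair_schlafliY ν).left x hx).congr_of_eventuallyEq ?_
    filter_upwards [Ioi_mem_nhds hx] with t ht using besselY_eq_schlafliY ν ht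
  right x hx := by
    rw [besselY_eq_schlafliY ν hx, besselY_eq_schlafliY (ν + 1) hx]
    refine ((isBesselPair_schlafliY ν).right x hx).congr_of_eventuallyEq ?_
    filter_upwards [Ioi_mem_nhds hx] with t ht using besselY_eq_schlafliY (ν + 1) ht

theorem besselY_self_neg {ν : ℝ} (hν : 0 < ν) : besselY ν ν < 0 := by
  rw [besselY_eq_schlafliY ν hν]
  exact schlafliY_self_neg hν

theorem besselY_euler_self_pos {ν : ℝ} (hν : 0 < ν) :
    0 < ν * besselY ν ν - ν * besselY (ν + 1) ν := by
  have h := deriv_schlafliY_self_pos hν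
  rw [(isBesselPair_schlafliY ν).deriv_left hν, ← besselY_eq_schlafliY ν hν,
    ← besselY_eq_schlafliY (ν + 1) hν] at h
  exact (div_pos_iff_of_pos_right hν).mp h

theorem besselY_mul_euler_neg {ν : ℝ} (hν : 0 < ν) {x : ℝ} (hx : x ∈ Ioc 0 ν) :
    besselY ν x * (ν * besselY ν x - x * besselY (ν + 1) x) < 0 :=
  ((isBesselPair_besselY ν).monotoneOn_mul_euler hx ⟨hν, le_rfl⟩ hx.2).trans_lt
    (mul_neg_of_neg_of_pos (besselY_self_neg hν) (besselY_euler_self_pos hν))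

/-- It suffices to look at x = ν, where J J' > 0 while Y < 0 < Y', so J Y' and J' Y have opposite
signs. -/
theorem besselJ_besselY_wronskian_ne_zero {ν : ℝ} (hν : 0 < ν) {x : ℝ} (hx : 0 < x) :
    besselJ ν x * besselY (ν + 1) x - besselJ (ν + 1) x * besselY ν x ≠ 0 := by
  intro h0
  have hW := (isBesselPair_besselJ ν).wronskian_eq (isBesselPair_besselY ν) hx hν
  rw [h0, mul_zero] at hW
  have hJ := besselJ_mul_euler_pos hν ⟨hν, le_rfl⟩
  have hY := besselY_self_neg hν
  have hY' := besselY_euler_self_pos hν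
  have hW' : besselJ ν ν * (ν * besselY ν ν - ν * besselY (ν + 1) ν) =
      (ν * besselJ ν ν - ν * besselJ (ν + 1) ν) * besselY ν ν := by
    linear_combination hW
  rcases mul_pos_iff.mp hJ with ⟨h1, h2⟩ | ⟨h1, h2⟩
  · have := mul_pos h1 hY'
    have := mul_neg_of_pos_of_neg h2 hY
    linarith
  · have := mul_neg_of_neg_of_pos h1 hY'
    have := mul_pos_of_neg_of_neg h2 hY
    linarith

theorem besselJ_ne_zero_of_eq_zero {ν : ℝ} (hν : 0 < ν) (x : ℝ) (hx : 0 < x)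
    (h : besselJ ν x = 0) : besselJ (ν + 1) x ≠ 0 := fun h' =>
  besselJ_besselY_wronskian_ne_zero hν hx (by rw [h, h']; ring)

theorem besselY_ne_zero_of_eq_zero {ν : ℝ} (hν : 0 < ν) (x : ℝ) (hx : 0 < x)
    (h : besselY ν x = 0) : besselY (ν + 1) x ≠ 0 := fun h' =>
  besselJ_besselY_wronskian_ne_zero hν hx (by rw [h, h']; ring)

/-! ### Interlacing of the zeros -/

theorem exists_isNthElement_besselJZeros {ν : ℝ} (hν : 0 ≤ ν) {s : ℕ} (hs : 1 ≤ s) :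
    ∃ j, IsNthElement (besselJZeros (ν + 1)) s j := by
  have hν1 : 0 < ν + 1 := by linarith
  refine exists_isNthElement (fun x hx => hx.1.le)
    ((isBesselPair_besselJ (ν + 1)).finite_left_zeros hν1
      (fun x hx => (besselJ_mul_euler_pos hν1 hx).ne') (besselJ_ne_zero_of_eq_zero hν1))
    (fun X => ?_) s hs
  obtain ⟨x, hx, h0⟩ := (isBesselPair_besselJ ν).exists_right_eq_zero_gt (max X 0)
  exact ⟨x, ⟨(le_max_right X 0).trans_lt hx, h0⟩, (le_max_left X 0).trans_lt hx⟩

theorem exists_isNthElement_besselYZeros {ν : ℝ} (hν : 0 ≤ ν) {s : ℕ} (hs : 1 ≤ s) :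
    ∃ y, IsNthElement (besselYZeros (ν + 1)) s y := by
  have hν1 : 0 < ν + 1 := by linarith
  refine exists_isNthElement (fun x hx => hx.1.le)
    ((isBesselPair_besselY (ν + 1)).finite_left_zeros hν1
      (fun x hx => (besselY_mul_euler_neg hν1 hx).ne) (besselY_ne_zero_of_eq_zero hν1))
    (fun X => ?_) s hs
  obtain ⟨x, hx, h0⟩ := (isBesselPair_besselY ν).exists_right_eq_zero_gt (max X 0)
  exact ⟨x, ⟨(le_max_right X 0).trans_lt hx, h0⟩, (le_max_left X 0).trans_lt hx⟩

theorem besselJDerivZeros_of_pos {ν : ℝ} (hν : 0 < ν) :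
    besselJDerivZeros ν = {x | 0 < x ∧ deriv (besselJ ν) x = 0} := by
  ext x
  simp [besselJDerivZeros, hν.ne']

theorem besselJDerivZeros_zero : besselJDerivZeros 0 = insert 0 (besselJZeros (0 + 1)) := by
  ext x
  have h : 0 < x → (deriv (besselJ 0) x = 0 ↔ besselJ (0 + 1) x = 0) := by
    intro hx
    rw [(isBesselPair_besselJ 0).deriv_left_eq_zero_iff hx]
    simp [hx.ne']
  simp only [besselJDerivZeros, besselJZeros, mem_ofPred_eq, mem_insert_iff, true_and]
  tauto

theorem besselYDerivZeros_zero : besselYDerivZeros 0 = besselYZeros (0 + 1) := by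
  ext x
  simp only [besselYDerivZeros, besselYZeros, mem_ofPred_eq]
  refine and_congr_right fun hx => ?_
  rw [(isBesselPair_besselY 0).deriv_left_eq_zero_iff hx]
  simp [hx.ne']

theorem exists_isNthElement_besselJDerivZeros {ν : ℝ} (hν : 0 < ν) {s : ℕ} {j : ℝ}
    (hj : IsNthElement (besselJZeros (ν + 1)) s j) :
    ∃ j', IsNthElement (besselJDerivZeros ν) (s + 1) j' ∧ j < j' := by
  have hpair := isBesselPair_besselJ ν
  have hne : ∀ x ∈ Ioc 0 ν, besselJ ν x * (ν * besselJ ν x - x * besselJ (ν + 1) x) ≠ 0 :=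
    fun x hx => (besselJ_mul_euler_pos hν hx).ne'
  have hsim := besselJ_ne_zero_of_eq_zero hν
  have hfin := hpair.finite_deriv_left_zeros hν hne hsim
  rw [besselJDerivZeros_of_pos hν]
  obtain ⟨j', hj'⟩ := exists_isNthElement (fun x hx => hx.1.le) hfin (fun X => by
    obtain ⟨x, hx, h0⟩ := hpair.exists_deriv_left_eq_zero_gt (max X 0)
    exact ⟨x, ⟨(le_max_right X 0).trans_lt hx, h0⟩, (le_max_left X 0).trans_lt hx⟩)
    (s + 1) (Nat.le_add_left 1 s)
  refine ⟨j', hj', hj.lt_of_between hfin (fun b hb b' hb' hbb' => ?_) hj'⟩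
  obtain ⟨c, hc, hbc, hcb⟩ := hpair.exists_right_eq_zero_between hν hsim
    (hpair.lt_of_deriv_left_eq_zero hne hb.1 hb.2).le hbb'
    ((hpair.deriv_left_eq_zero_iff hb.1).mp hb.2) ((hpair.deriv_left_eq_zero_iff hb'.1).mp hb'.2)
  exact ⟨c, ⟨hb.1.trans hbc, hc⟩, hbc, hcb⟩

theorem exists_isNthElement_besselYDerivZeros {ν : ℝ} (hν : 0 < ν) {s : ℕ} (hs : 1 ≤ s) {y : ℝ}
    (hy : IsNthElement (besselYZeros (ν + 1)) s y) :
    ∃ y', IsNthElement (besselYDerivZeros ν) s y' ∧ y < y' := by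
  have hpair := isBesselPair_besselY ν
  have hne : ∀ x ∈ Ioc 0 ν, besselY ν x * (ν * besselY ν x - x * besselY (ν + 1) x) ≠ 0 :=
    fun x hx => (besselY_mul_euler_neg hν hx).ne
  have hsim := besselY_ne_zero_of_eq_zero hν
  have hfin : ∀ X, (besselYDerivZeros ν ∩ Iic X).Finite :=
    hpair.finite_deriv_left_zeros hν hne hsim
  obtain ⟨y', hy'⟩ := exists_isNthElement (S := besselYDerivZeros ν) (fun x hx => hx.1.le) hfin
    (fun X => by
      obtain ⟨x, hx, h0⟩ := hpair.exists_deriv_left_eq_zero_gt (max X 0)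
      exact ⟨x, ⟨(le_max_right X 0).trans_lt hx, h0⟩, (le_max_left X 0).trans_lt hx⟩) s hs
  -- Adjoining 0 to the zeros of Y'_ν creates one more gap, from 0 to the first zero; the signs at ν
  -- fill it, and the indices become s and s + 1.
  refine ⟨y', hy', hy.lt_of_between (B := insert 0 (besselYDerivZeros ν)) (fun X => ?_)
    (fun b hb b' hb' hbb' => ?_) (hy'.insert_zero fun x hx => hx.1)⟩
  · refine ((hfin X).insert 0).subset ?_
    rintro t ⟨rfl | ht, htX⟩
    · exact mem_insert _ _
    · exact mem_insert_of_mem _ ⟨ht, htX⟩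
  · have hb0 : 0 ≤ b := by
      rcases hb with rfl | hb
      exacts [le_rfl, hb.1.le]
    have hb'2 := hb'.resolve_left (hb0.trans_lt hbb').ne'
    have hνb' := hpair.lt_of_deriv_left_eq_zero hne hb'2.1 hb'2.2
    have hE' := (hpair.deriv_left_eq_zero_iff hb'2.1).mp hb'2.2
    rcases hb with rfl | hb
    · obtain ⟨c, hc, hc0, hcb⟩ := hpair.exists_right_eq_zero_lt hν hsim hνb'
        (besselY_self_neg hν) (besselY_euler_self_pos hν) hE'
      exact ⟨c, ⟨hc0, hc⟩, hc0, hcb⟩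
    · obtain ⟨c, hc, hbc, hcb⟩ := hpair.exists_right_eq_zero_between hν hsim
        (hpair.lt_of_deriv_left_eq_zero hne hb.1 hb.2).le hbb'
        ((hpair.deriv_left_eq_zero_iff hb.1).mp hb.2) hE'
      exact ⟨c, ⟨hb.1.trans hbc, hc⟩, hbc, hcb⟩

end

theorem proposition2 (ν : ℝ) (hν : 0 ≤ ν) (s : ℕ) (hs : 1 ≤ s) :
    ∃ j j' y y' : ℝ,
      IsNthElement (besselJZeros (ν + 1)) s j ∧
      IsNthElement (besselJDerivZeros ν) (s + 1) j' ∧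
      IsNthElement (besselYZeros (ν + 1)) s y ∧
      IsNthElement (besselYDerivZeros ν) s y' ∧
      (0 < ν → j < j' ∧ y < y') ∧
      (ν = 0 → j = j' ∧ y = y') := by
  obtain ⟨j, hj⟩ := exists_isNthElement_besselJZeros hν hs
  obtain ⟨y, hy⟩ := exists_isNthElement_besselYZeros hν hs
  rcases hν.eq_or_lt with rfl | hpos
  · refine ⟨j, j, y, y, hj, ?_, hy, ?_, fun h => absurd h (lt_irrefl _), fun _ => ⟨rfl, rfl⟩⟩
    · rw [besselJDerivZeros_zero]
      exact hj.insert_zero fun x hx => hx.1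
    · rw [besselYDerivZeros_zero]
      exact hy
  · obtain ⟨j', hj', hlt⟩ := exists_isNthElement_besselJDerivZeros hpos hj
    obtain ⟨y', hy', hlt'⟩ := exists_isNthElement_besselYDerivZeros hpos hs hy
    exact ⟨j, j', y, y', hj, hj', hy, hy', fun _ => ⟨hlt, hlt'⟩, fun h => absurd h hpos.ne'⟩
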